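/- For $\beta\in[0,1]$, $m>0$, $\sigma\ge 0$ let $\mathcal M_\beta(m,\sigma^{\beta+1})$ be the class of probability measures $\mu$ on $\mathbb R$ such that $\nu^+([x,\infty))\le\sigma^{\beta+1}\mu([x,\infty))$ for all $x\ge m$ and $\nu^-((-\infty,x])\le\sigma^{\beta+1}\mu((-\infty,x])$ for all $x\le -m$, where $\nu^+$ is the measure on $[m,\infty)$ with density $x^\beta\mu([x,\infty))$ and $\nu^-$ is the measure on $(-\infty,-m]$ with density $|x|^\beta\mu((-\infty,x])$. Write $\|v\|_p$ for the $\ell_p^n$ norm on $\mathbb R^n$, $|v|=\|v\|_2$, and $\mathrm{Ent}\,Y=\mathbb E\,Y\log Y-\mathbb E\,Y\log\mathbb E\,Y$ ($=\infty$ if $Y\log Y$ is not integrable) for $Y\ge0$. Fix $\beta\in[0,1]$, $m>0$, $\sigma\ge0$. Call $C\in(0,\infty)$ *admissible* if for all $n$, all independent random variables $X_1,\dots,X_n$ with laws in $\mathcal M_\beta(m,\sigma^{\beta+1})$ and all smooth convex Lipschitz $\varphi:\mathbb R^n\to\mathbb R$, with $X=(X_1,\dots,X_n)$: - if $\beta>0$: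 $\ \mathrm{Ent}\,e^{\varphi(X)}\le C\,\mathbb E\Big(|\nabla\varphi(X)|^2\vee\|\nabla\varphi(X)\|_{(\beta+1)/\beta}^{(\beta+1)/\beta}\Big)e^{\varphi(X)}$; - if $\beta=0$ and $|\partial_i\varphi(x)|\le 1/(2(m+3\sigma))$ for all $x$ and $i$: $\ \mathrm{Ent}\,e^{\varphi(X)}\le C\,\mathbb E|\nabla\varphi(X)|^2e^{\varphi(X)}$. Then an admissible constant $C=C(\beta,m,\sigma)$ exists. Moreover, for every admissible $C$, every $n$, all independent $X_1,\dots,X_n$ with laws in $\mathcal M_\beta(m,\sigma^{\beta+1})$ and every smooth convex Lipschitz $\varphi:\mathbb R^n\to\mathbb R$, the random variable $\varphi(X)$ is integrable and, for all $t\ge0$: if $\beta\in(0,1]$, then $$\mathbb P\big(\varphi(X)\ge\mathbb E\varphi(X)+t\big)\le\exp\Big(-\frac3{16}\min\Big\{\frac{t^2}{C\sup|\nabla\varphi|^2},\ \frac{t^{1+\beta}}{C^\beta\sup\|\nabla\varphi\|_{(\beta+1)/\beta}^{1+\beta}}\Big\}\Big);$$ if $\beta=0$, then $$\mathbb P\big(\varphi(X)\ge\mathbb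 E\varphi(X)+t\big)\le\exp\Big(-\frac14\min\Big\{\frac{t^2}{C\sup|\nabla\varphi|^2},\ \frac{t}{(m+3\sigma)\sup\|\nabla\varphi\|_\infty}\Big\}\Big).$$ The suprema are over $x\in\mathbb R^n$. If $\nabla\varphi\equiv0$, the quotients are read as $a/0=+\infty$ for $a>0$ and $0/0=0$, so that the bounds say that the probability is $0$ for every $t>0$. -/

import Mathlib

open MeasureTheory ProbabilityTheory
open scoped ENNReal

noncomputable section

/-- The measure on `[m, ∞)` with density `x ^ β * μ [x, ∞)`. -/
def nuPlus (β m : ℝ) (μ : Measure ℝ) : Measure ℝ :=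
  (volume.restrict (Set.Ici m)).withDensity
    (fun x => ENNReal.ofReal (x ^ β) * μ (Set.Ici x))

/-- The measure on `(-∞, -m]` with density `|x| ^ β * μ (-∞, x]`. -/
def nuMinus (β m : ℝ) (μ : Measure ℝ) : Measure ℝ :=
  (volume.restrict (Set.Iic (-m))).withDensity
    (fun x => ENNReal.ofReal (|x| ^ β) * μ (Set.Iic x))

/-- The class `𝓜_β(m, σ ^ (β + 1))` of probability distributions on the line. -/
structure MemClassM (β m σ : ℝ) (μ : Measure ℝ) : Prop where
  isProbabilityMeasure : IsProbabilityMeasure μ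
  right_tail : ∀ x, m ≤ x →
    nuPlus β m μ (Set.Ici x) ≤ ENNReal.ofReal (σ ^ (β + 1)) * μ (Set.Ici x)
  left_tail : ∀ x, x ≤ -m →
    nuMinus β m μ (Set.Iic x) ≤ ENNReal.ofReal (σ ^ (β + 1)) * μ (Set.Iic x)

/-- The gradient (vector of partial derivatives) of a function on `ℝⁿ`. -/
def grad {n : ℕ} (φ : (Fin n → ℝ) → ℝ) (x : Fin n → ℝ) : Fin n → ℝ :=
  fun i => fderiv ℝ φ x (Pi.single i 1)

/-- The norm `‖v‖_p = (∑ |v_i| ^ p) ^ (1 / p)` on `ℝⁿ`, for finite `p`. -/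
def ellNorm {n : ℕ} (p : ℝ) (v : Fin n → ℝ) : ℝ :=
  (∑ i, |v i| ^ p) ^ (1 / p)

/-- The norm `‖v‖_∞ = max |v_i|` on `ℝⁿ`. -/
def ellInftyNorm {n : ℕ} (v : Fin n → ℝ) : ℝ :=
  ⨆ i, |v i|

/-- Smooth convex Lipschitz functions on `ℝⁿ` (being Lipschitz does not depend on the norm). -/
structure IsSmoothConvexLipschitz {n : ℕ} (φ : (Fin n → ℝ) → ℝ) : Prop where
  smooth : ContDiff ℝ ((⊤ : ℕ∞) : WithTop ℕ∞) φ
  convex : ConvexOn ℝ Set.univ φ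
  lipschitz : ∃ K, LipschitzWith K φ

open scoped Classical in
/-- The entropy `Ent Y = E Y log Y - E Y log E Y` of a non-negative random variable `Y` under the
probability measure `μ`, equal to `+∞` if `Y log Y` is not integrable. -/
def entropy {α : Type*} [MeasurableSpace α] (μ : Measure α) (Y : α → ℝ) : EReal :=
  if Integrable (fun x => Y x * Real.log (Y x)) μ then
    (((∫ x, Y x * Real.log (Y x) ∂μ) - (∫ x, Y x ∂μ) * Real.log (∫ x, Y x ∂μ) : ℝ) : EReal)
  else ⊤

/-- `C` is an admissible constant in the dimension-free modified log-Sobolev inequality for convex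
functions with parameters `β, m, σ`. As `X₁, …, Xₙ` are independent, the law of
`(X₁, …, Xₙ)` is the product of their laws `μ 1, …, μ n`. -/
def IsModLogSobolevConst (β m σ C : ℝ) : Prop :=
  0 < C ∧
  ∀ (n : ℕ) (μ : Fin n → Measure ℝ), (∀ i, MemClassM β m σ (μ i)) →
  ∀ φ : (Fin n → ℝ) → ℝ, IsSmoothConvexLipschitz φ →
    (0 < β →
      entropy (Measure.pi μ) (fun x => Real.exp (φ x)) ≤
        ((C * ∫ x, max (ellNorm 2 (grad φ x) ^ 2)
            (ellNorm ((β + 1) / β) (grad φ x) ^ ((β + 1) / β)) * Real.exp (φ x)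
          ∂(Measure.pi μ) : ℝ) : EReal)) ∧
    (β = 0 → (∀ x i, |grad φ x i| ≤ 1 / (2 * (m + 3 * σ))) →
      entropy (Measure.pi μ) (fun x => Real.exp (φ x)) ≤
        ((C * ∫ x, ellNorm 2 (grad φ x) ^ 2 * Real.exp (φ x) ∂(Measure.pi μ) : ℝ) : EReal))

end

/-! By the layer-cake formula and Fubini, the tail condition is a Hardy-type inequality: for
nonnegative nondecreasing `g` on `[m, ∞)`, the `μ`-integral over `[m, ∞)` of `x ↦ ∫_m^x y^β g(y) dy`
is at most `σ^(β+1)` times that of `g`. Truncated exponentials as `g` give exponential moments,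
hence second moments bounded uniformly over the class.

On the line, `Ent e^φ ≤ ∫ e^c entPot(φ - c)` for every `c`. Take `c = φ(M)`, where `M` minimises `φ`
on an interval `[-R, R]` carrying at least half of the mass. Where `φ < c`, the tangent at `M` gives
a bound by `φ'(M)² (x - M)²`, and the second moment controls it. Where `φ ≥ c` and `|x| < m`, the
tangent at `x` gives `φ - c ≤ 2m |φ'(x)|`. On the tails the Hardy inequality is applied to the
derivative of `entPot((φ - c)⁺)` divided by `(y - M)^β`. Convexity makes this nondecreasing: it is a
product of the secant slope, `(y - M)^(1-β)`, `φ'` and `e^(φ-c)`. The result is split by Young's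
inequality (`exists_absorption`): one part is absorbed in the left side, the rest is the cost of
`φ'`.

Subadditivity of entropy (`expEnt_prod_le`) tensorizes this with no loss in the dimension, which
gives an admissible constant. Concentration is Herbst's argument. Let `T` be the minimum in the
exponent and `K = t²/T`; for `0 < s ≤ T/(2t)` the entropy of `e^(sφ)` is at most `K s² E e^(sφ)`,
and Chernoff's bound at `s = T/(2t)` gives `exp(-T/4)`. -/

/-! ### The class: change of `m`, reflection, monotone test functions. -/

/-- Raising `m` only discards part of `ν⁺` and `ν⁻`. The proof uses this freely, to make room for `R
+ 1 ≤ m` and to reach larger exponential moments. -/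
theorem MemClassM.mono {β m m' σ : ℝ} {μ : Measure ℝ} (h : MemClassM β m σ μ) (hm : m ≤ m') :
    MemClassM β m' σ μ := by
  refine ⟨h.1, fun x hx => le_trans ?_ (h.2 x (hm.trans hx)),
    fun x hx => le_trans ?_ (h.3 x (by linarith))⟩
  · unfold nuPlus
    refine Measure.le_iff'.1 ?_ _
    rw [← restrict_withDensity measurableSet_Ici, ← restrict_withDensity measurableSet_Ici]
    exact Measure.restrict_mono (Set.Ici_subset_Ici.2 hm) le_rfl
  · unfold nuMinus
    refine Measure.le_iff'.1 ?_ _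
    rw [← restrict_withDensity measurableSet_Iic, ← restrict_withDensity measurableSet_Iic]
    exact Measure.restrict_mono (Set.Iic_subset_Iic.2 (by linarith)) le_rfl

theorem measurable_measure_Ici (μ : Measure ℝ) : Measurable fun x => μ (Set.Ici x) :=
  Antitone.measurable fun _ _ h => measure_mono (Set.Ici_subset_Ici.2 h)

theorem nuMinus_map_neg (β m : ℝ) (μ : Measure ℝ) (hm : 0 ≤ m) (x : ℝ) :
    nuMinus β m (μ.map Neg.neg) (Set.Iic x) = nuPlus β m μ (Set.Ici (-x)) := by
  unfold nuMinus nuPlus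
  rw [withDensity_apply _ measurableSet_Iic, withDensity_apply _ measurableSet_Ici,
    Measure.restrict_restrict measurableSet_Iic, Measure.restrict_restrict measurableSet_Ici,
    ← lintegral_indicator (measurableSet_Iic.inter measurableSet_Iic),
    ← lintegral_indicator (measurableSet_Ici.inter measurableSet_Ici),
    ← lintegral_neg_eq_self]
  refine lintegral_congr fun y => ?_
  simp only [Set.indicator, Set.mem_inter_iff, Set.mem_Iic, Set.mem_Ici]
  by_cases hy : -x ≤ y ∧ m ≤ y
  · rw [if_pos (by constructor <;> linarith [hy.1, hy.2]), if_pos hy, abs_neg,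
      abs_of_nonneg (hm.trans hy.2),
      Measure.map_apply measurable_neg measurableSet_Iic]
    simp
  · rw [if_neg (fun h => hy ⟨by linarith [h.1], by linarith [h.2]⟩), if_neg hy]

theorem nuPlus_map_neg (β m : ℝ) (μ : Measure ℝ) (hm : 0 ≤ m) (x : ℝ) :
    nuPlus β m (μ.map Neg.neg) (Set.Ici x) = nuMinus β m μ (Set.Iic (-x)) := by
  have h := nuMinus_map_neg β m (μ.map Neg.neg) hm (-x)
  rw [Measure.map_map measurable_neg measurable_neg] at h
  simpa using h.symm

/-- Reflection exchanges the two tail conditions, so left-tail estimates follow from right-tail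
ones. -/
theorem MemClassM.map_neg {β m σ : ℝ} {μ : Measure ℝ} (h : MemClassM β m σ μ) (hm : 0 ≤ m) :
    MemClassM β m σ (μ.map Neg.neg) := by
  have := h.1
  refine ⟨Measure.isProbabilityMeasure_map measurable_neg.aemeasurable, fun x hx => ?_,
    fun x hx => ?_⟩
  · rw [nuPlus_map_neg _ _ _ hm, Measure.map_apply measurable_neg measurableSet_Ici]
    simpa using h.3 (-x) (by linarith)
  · rw [nuMinus_map_neg _ _ _ hm, Measure.map_apply measurable_neg measurableSet_Iic]
    simpa using h.2 (-x) (by linarith)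

/-- Closed upper subsets of a half-line are rays. -/
theorem isUpper_closed_cases {m : ℝ} {s : Set ℝ} (hs : IsClosed s) (hsub : s ⊆ Set.Ici m)
    (hup : ∀ x ∈ s, ∀ y, x ≤ y → y ∈ s) : s = ∅ ∨ ∃ a, m ≤ a ∧ s = Set.Ici a := by
  rcases s.eq_empty_or_nonempty with h | h
  · exact Or.inl h
  · have hb : BddBelow s := ⟨m, fun x hx => hsub hx⟩
    have hmem := hs.csInf_mem h hb
    exact Or.inr ⟨sInf s, hsub hmem, Set.Subset.antisymm (fun x hx => csInf_le hb hx)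
      fun x hx => hup _ hmem _ hx⟩

/-- Superlevel sets of a nondecreasing continuous `g` within `[m, ∞)` are closed rays or empty,
exactly the sets on which the tail condition speaks; the layer-cake formula integrates over levels.
-/
theorem MemClassM.lintegral_nuPlus_le {β m σ : ℝ} {μ : Measure ℝ} (h : MemClassM β m σ μ)
    {g : ℝ → ℝ} (hg : Continuous g) (hg0 : ∀ x, m ≤ x → 0 ≤ g x) (hgm : MonotoneOn g (Set.Ici m)) :
    ∫⁻ x in Set.Ici m, ENNReal.ofReal (g x) ∂(nuPlus β m μ) ≤
      ENNReal.ofReal (σ ^ (β + 1)) * ∫⁻ x in Set.Ici m, ENNReal.ofReal (g x) ∂μ := by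
  have key : ∀ ν : Measure ℝ, ∫⁻ x in Set.Ici m, ENNReal.ofReal (g x) ∂ν =
      ∫⁻ t in Set.Ioi 0, ν ({x | t ≤ g x} ∩ Set.Ici m) := by
    intro ν
    rw [lintegral_eq_lintegral_meas_le]
    · refine lintegral_congr fun t => ?_
      rw [Measure.restrict_apply' measurableSet_Ici]
    · exact (ae_restrict_iff' measurableSet_Ici).2 (Filter.Eventually.of_forall hg0)
    · exact hg.aemeasurable
  rw [key, key, ← lintegral_const_mul' _ _ ENNReal.ofReal_ne_top]
  refine lintegral_mono fun t => ?_
  rcases isUpper_closed_cases (m := m) (s := {x | t ≤ g x} ∩ Set.Ici m)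
    ((isClosed_le continuous_const hg).inter isClosed_Ici) Set.inter_subset_right
    (fun x hx y hxy => ⟨le_trans hx.1 (hgm hx.2 (le_trans hx.2 hxy) hxy), le_trans hx.2 hxy⟩)
    with h0 | ⟨a, ha, h0⟩
  · simp [h0]
  · simpa only [h0] using h.2 a ha

/-- Transfer of tails: the defining property of the class tested on monotone functions. -/
theorem MemClassM.lintegral_lintegral_le {β m σ : ℝ} {μ : Measure ℝ} (h : MemClassM β m σ μ)
    (hm : 0 ≤ m)
    {g : ℝ → ℝ} (hg : Continuous g) (hg0 : ∀ x, m ≤ x → 0 ≤ g x) (hgm : MonotoneOn g (Set.Ici m)) :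
    ∫⁻ x in Set.Ici m, (∫⁻ y in Set.Icc m x, ENNReal.ofReal (y ^ β * g y)) ∂μ ≤
      ENNReal.ofReal (σ ^ (β + 1)) * ∫⁻ x in Set.Ici m, ENNReal.ofReal (g x) ∂μ := by
  have := h.1
  refine le_trans (le_of_eq ?_) (h.lintegral_nuPlus_le hg hg0 hgm)
  have hmeas : Measurable fun x : ℝ => ENNReal.ofReal (x ^ β) * μ (Set.Ici x) :=
    (Measurable.ennreal_ofReal (by fun_prop)).mul (measurable_measure_Ici μ)
  unfold nuPlus
  rw [setLIntegral_withDensity_eq_setLIntegral_mul _ hmeas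
    hg.measurable.ennreal_ofReal measurableSet_Ici, Measure.restrict_restrict measurableSet_Ici,
    Set.inter_self]
  have h1 : ∀ x, ∫⁻ y in Set.Icc m x, ENNReal.ofReal (y ^ β * g y) =
      ∫⁻ y in Set.Ici m, (Set.Iic x).indicator (fun y => ENNReal.ofReal (y ^ β * g y)) y := by
    intro x
    rw [setLIntegral_indicator measurableSet_Iic, Set.inter_comm, Set.Ici_inter_Iic]
  simp_rw [h1]
  rw [lintegral_lintegral_swap]
  · refine setLIntegral_congr_fun measurableSet_Ici fun y hy => ?_
    have hy' : m ≤ y := hy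
    have : ∀ x, (Set.Iic x).indicator (fun y => ENNReal.ofReal (y ^ β * g y)) y =
        (Set.Ici y).indicator (fun _ => ENNReal.ofReal (y ^ β * g y)) x := by
      intro x
      simp [Set.indicator]
    simp_rw [this]
    rw [lintegral_indicator_const measurableSet_Ici, Measure.restrict_apply measurableSet_Ici,
      Set.inter_eq_left.2 (Set.Ici_subset_Ici.2 hy'),
      ENNReal.ofReal_mul (Real.rpow_nonneg (hm.trans hy') _)]
    simp only [Pi.mul_apply]
    ring
  · have : (Function.uncurry fun x y : ℝ =>
        (Set.Iic x).indicator (fun y => ENNReal.ofReal (y ^ β * g y)) y) =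
        Set.indicator {p : ℝ × ℝ | p.2 ≤ p.1} fun p => ENNReal.ofReal (p.2 ^ β * g p.2) := by
      ext ⟨x, y⟩
      simp [Set.indicator]
    rw [this]
    refine (Measurable.indicator ?_ (measurableSet_le measurable_snd measurable_fst)).aemeasurable
    have := hg.measurable
    fun_prop

/-! ### Exponential moments and the uniform second moment bound. -/

/-- The exponential is its value at `m` plus the integral of its derivative. The Hardy inequality
bounds the second part by half of the moment itself, which is absorbed. -/
theorem MemClassM.lintegral_exp_Ici_le {β m σ L : ℝ} {μ : Measure ℝ} (h : MemClassM β m σ μ)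
    (hm : 0 < m) (hβ : 0 ≤ β) (hL : 0 < L) (hLs : 2 * L * σ ^ (β + 1) ≤ m ^ β) :
    ∫⁻ x in Set.Ici m, ENNReal.ofReal (Real.exp (L * x)) ∂μ ≤
      ENNReal.ofReal (2 * Real.exp (L * m)) := by
  have := h.1
  have hmb : 0 < m ^ β := Real.rpow_pos_of_pos hm _
  -- Truncation at `N` makes the moment finite, so that it may be subtracted from both sides;
  -- Fatou's lemma removes `N` at the end.
  have trunc : ∀ N : ℝ, m ≤ N →
      ∫⁻ x in Set.Ici m, ENNReal.ofReal (Real.exp (L * min x N)) ∂μ ≤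
        ENNReal.ofReal (2 * Real.exp (L * m)) := by
    intro N hN
    set g : ℝ → ℝ := fun y => Real.exp (L * min y N) with hgdef
    have hg : Continuous g := by fun_prop
    have hgm : Monotone g := fun a b hab =>
      Real.exp_le_exp.2 (mul_le_mul_of_nonneg_left (min_le_min_right _ hab) hL.le)
    have hg0 : ∀ x, 0 ≤ g x := fun x => (Real.exp_pos _).le
    have hT := h.lintegral_lintegral_le hm.le hg (fun x _ => hg0 x) (hgm.monotoneOn _)
    set I := ∫⁻ x in Set.Ici m, ENNReal.ofReal (g x) ∂μ with hI
    have hfin : I ≠ ∞ := by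
      refine ne_of_lt (lt_of_le_of_lt
        (lintegral_mono (g := fun _ => ENNReal.ofReal (Real.exp (L * N))) fun x => ?_) ?_)
      · exact ENNReal.ofReal_le_ofReal
          (Real.exp_le_exp.2 (mul_le_mul_of_nonneg_left (min_le_right _ _) hL.le))
      · rw [lintegral_const]
        exact ENNReal.mul_lt_top ENNReal.ofReal_lt_top (measure_lt_top _ _)
    -- The weight `y^β` required by the Hardy inequality is inserted through `1 ≤ m^(-β) y^β` for `y
    -- ≥ m`.
    have pt : ∀ x ∈ Set.Ici m, ENNReal.ofReal (g x) ≤ ENNReal.ofReal (Real.exp (L * m)) +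
        ENNReal.ofReal (L * (m ^ β)⁻¹) * ∫⁻ y in Set.Icc m x, ENNReal.ofReal (y ^ β * g y) := by
      intro x hx
      have hx' : m ≤ min x N := le_min hx hN
      have h1 : g x = Real.exp (L * m) + ∫ y in m..(min x N), L * Real.exp (L * y) := by
        have : ∀ y ∈ Set.uIcc m (min x N),
            HasDerivAt (fun y => Real.exp (L * y)) (L * Real.exp (L * y)) y := by
          intro y _
          have := ((hasDerivAt_id y).const_mul L).exp
          simpa [mul_comm] using this
        rw [intervalIntegral.integral_eq_sub_of_hasDerivAt this
          (Continuous.intervalIntegrable (by fun_prop) _ _)]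
        simp [hgdef]
      rw [h1, ENNReal.ofReal_add (Real.exp_pos _).le
        (intervalIntegral.integral_nonneg hx' fun y _ => by positivity)]
      gcongr
      rw [intervalIntegral.integral_of_le hx', ofReal_integral_eq_lintegral_ofReal
        ((Continuous.intervalIntegrable (by fun_prop) _ _).1 )
        (Filter.Eventually.of_forall fun y => by positivity),
        ← lintegral_const_mul' _ _ ENNReal.ofReal_ne_top]
      refine le_trans (setLIntegral_mono' measurableSet_Ioc fun y hy => ?_)
        (lintegral_mono_set (Set.Ioc_subset_Icc_self.trans
          (Set.Icc_subset_Icc_right (min_le_left _ _))))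
      rw [← ENNReal.ofReal_mul (by positivity)]
      refine ENNReal.ofReal_le_ofReal ?_
      have hgy : g y = Real.exp (L * y) := by
        simp only [hgdef, min_eq_left (hy.2.trans (min_le_right _ _))]
      have hyb : m ^ β ≤ y ^ β := Real.rpow_le_rpow hm.le hy.1.le hβ
      have : 1 ≤ (m ^ β)⁻¹ * y ^ β := by
        rw [inv_mul_eq_div]; exact (one_le_div hmb).2 hyb
      rw [hgy]
      have h3 : L * (m ^ β)⁻¹ * (y ^ β * Real.exp (L * y)) =
        ((m ^ β)⁻¹ * y ^ β) * (L * Real.exp (L * y)) := by ring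
      rw [h3]
      exact le_mul_of_one_le_left (by positivity) this
    have h2 : I ≤ ENNReal.ofReal (Real.exp (L * m)) + ENNReal.ofReal (1 / 2) * I := by
      calc I ≤ ∫⁻ x in Set.Ici m, (ENNReal.ofReal (Real.exp (L * m)) +
            ENNReal.ofReal (L * (m ^ β)⁻¹) *
              ∫⁻ y in Set.Icc m x, ENNReal.ofReal (y ^ β * g y)) ∂μ :=
            setLIntegral_mono' measurableSet_Ici pt
        _ ≤ ENNReal.ofReal (Real.exp (L * m)) + ENNReal.ofReal (L * (m ^ β)⁻¹) *
              ∫⁻ x in Set.Ici m, (∫⁻ y in Set.Icc m x, ENNReal.ofReal (y ^ β * g y)) ∂μ := by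
            rw [lintegral_add_left measurable_const,
              lintegral_const_mul' _ _ ENNReal.ofReal_ne_top, lintegral_const]
            gcongr
            calc _ ≤ ENNReal.ofReal (Real.exp (L * m)) * 1 := by
                  gcongr; exact prob_le_one.trans' (Measure.restrict_apply_le _ _)
              _ = _ := mul_one _
        _ ≤ ENNReal.ofReal (Real.exp (L * m)) + ENNReal.ofReal (L * (m ^ β)⁻¹) *
              (ENNReal.ofReal (σ ^ (β + 1)) * I) := by gcongr
        _ ≤ _ := by
            rw [← mul_assoc, ← ENNReal.ofReal_mul (by positivity)]
            gcongr
            rw [mul_right_comm, ← div_eq_mul_inv, div_le_iff₀ hmb]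
            linarith
    have hIr := ENNReal.ofReal_toReal hfin
    rw [← hIr, ← ENNReal.ofReal_mul (by norm_num),
      ← ENNReal.ofReal_add (Real.exp_pos _).le (by positivity),
      ENNReal.ofReal_le_ofReal_iff (by positivity)] at h2
    rw [← hIr]
    exact ENNReal.ofReal_le_ofReal (by linarith)
  have hmono : ∀ᵐ x ∂(μ.restrict (Set.Ici m)),
      Filter.Tendsto (fun n : ℕ => ENNReal.ofReal (Real.exp (L * min x (m + n)))) Filter.atTop
        (nhds (ENNReal.ofReal (Real.exp (L * x)))) := by
    refine Filter.Eventually.of_forall fun x => tendsto_const_nhds.congr' ?_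
    filter_upwards [Filter.eventually_ge_atTop ⌈x - m⌉₊] with n hn
    have : x - m ≤ n := (Nat.le_ceil _).trans (by exact_mod_cast hn)
    rw [min_eq_left (by linarith)]
  calc _ = ∫⁻ x in Set.Ici m, Filter.liminf (fun n : ℕ =>
        ENNReal.ofReal (Real.exp (L * min x (m + n)))) Filter.atTop ∂μ :=
        lintegral_congr_ae (hmono.mono fun x hx => hx.liminf_eq.symm)
    _ ≤ _ := lintegral_liminf_le fun n => by fun_prop
    _ ≤ _ := by
      refine Filter.liminf_le_of_le (by isBoundedDefault) fun b hb => ?_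
      obtain ⟨n, hn⟩ := hb.exists
      exact hn.trans (trunc _ (by simp))

theorem MemClassM.lintegral_exp_abs_le {β m σ L : ℝ} {μ : Measure ℝ} (h : MemClassM β m σ μ)
    (hm : 0 < m) (hβ : 0 ≤ β) (hL : 0 < L) (hLs : 2 * L * σ ^ (β + 1) ≤ m ^ β) :
    ∫⁻ x, ENNReal.ofReal (Real.exp (L * |x|)) ∂μ ≤ ENNReal.ofReal (5 * Real.exp (L * m)) := by
  have := h.1
  have h1 := h.lintegral_exp_Ici_le hm hβ hL hLs
  have h2 := (h.map_neg hm.le).lintegral_exp_Ici_le hm hβ hL hLs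
  rw [setLIntegral_map measurableSet_Ici (by fun_prop) measurable_neg] at h2
  rw [Measure.restrict_congr_set (s := Neg.neg ⁻¹' Set.Ici m) (t := Set.Iic (-m))
    (by simp; rfl)] at h2
  calc ∫⁻ x, ENNReal.ofReal (Real.exp (L * |x|)) ∂μ
      ≤ ∫⁻ x, (ENNReal.ofReal (Real.exp (L * m)) +
        (Set.Ici m).indicator (fun x => ENNReal.ofReal (Real.exp (L * x))) x +
        (Set.Iic (-m)).indicator (fun x => ENNReal.ofReal (Real.exp (L * -x))) x) ∂μ := by
        refine lintegral_mono fun x => ?_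
        rcases le_or_gt |x| m with hx | hx
        · refine le_add_right (le_add_right (ENNReal.ofReal_le_ofReal ?_))
          exact Real.exp_le_exp.2 (mul_le_mul_of_nonneg_left hx hL.le)
        · rcases lt_abs.1 hx with hx' | hx'
          · refine le_add_right (le_add_left ?_)
            rw [Set.indicator_of_mem (show x ∈ Set.Ici m from hx'.le), abs_of_pos (hm.trans hx')]
          · refine le_add_left ?_
            rw [Set.indicator_of_mem (show x ∈ Set.Iic (-m) from Set.mem_Iic.2 (by linarith)),
              abs_of_neg (by linarith)]
    _ ≤ ENNReal.ofReal (Real.exp (L * m)) + ENNReal.ofReal (2 * Real.exp (L * m)) +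
        ENNReal.ofReal (2 * Real.exp (L * m)) := by
        rw [lintegral_add_right _ (Measurable.indicator (by fun_prop) measurableSet_Iic),
          lintegral_add_left measurable_const, lintegral_indicator measurableSet_Ici,
          lintegral_indicator measurableSet_Iic, lintegral_const, measure_univ, mul_one]
        gcongr
    _ = _ := by
        rw [← ENNReal.ofReal_add (by positivity) (by positivity),
          ← ENNReal.ofReal_add (by positivity) (by positivity)]
        congr 1; ring

theorem MemClassM.integrable_exp_abs {β m σ L : ℝ} {μ : Measure ℝ} (h : MemClassM β m σ μ)
    (hm : 0 < m) (hβ : 0 ≤ β) (hL : 0 < L) (hLs : 2 * L * σ ^ (β + 1) ≤ m ^ β) :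
    Integrable (fun x => Real.exp (L * |x|)) μ := by
  refine ⟨(by fun_prop : Continuous fun x : ℝ => Real.exp (L * |x|)).aestronglyMeasurable, ?_⟩
  rw [hasFiniteIntegral_iff_ofReal (Filter.Eventually.of_forall fun x => (Real.exp_pos _).le)]
  exact (h.lintegral_exp_abs_le hm hβ hL hLs).trans_lt ENNReal.ofReal_lt_top

/-- For `β > 0` the threshold `m^β` is unbounded in `m`, so enlarging `m` reaches every exponent. -/
theorem MemClassM.integrable_exp_abs_of_pos {β m σ : ℝ} {μ : Measure ℝ} (h : MemClassM β m σ μ)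
    (hm : 0 < m) (hσ : 0 ≤ σ) (hβ : 0 < β) (L : ℝ) :
    Integrable (fun x => Real.exp (L * |x|)) μ := by
  have hL : 0 < |L| + 1 := by positivity
  set m' := max m ((2 * (|L| + 1) * σ ^ (β + 1)) ^ (1 / β)) with hm'
  have hm0 : 0 < m' := lt_max_of_lt_left hm
  have hint := (h.mono (le_max_left _ _ : m ≤ m')).integrable_exp_abs hm0 hβ.le hL (by
    calc 2 * (|L| + 1) * σ ^ (β + 1) = ((2 * (|L| + 1) * σ ^ (β + 1)) ^ (1 / β)) ^ β := by
          rw [← Real.rpow_mul (by positivity), one_div_mul_cancel hβ.ne', Real.rpow_one]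
      _ ≤ m' ^ β := Real.rpow_le_rpow (by positivity) (le_max_right _ _) hβ.le)
  refine hint.mono' (by fun_prop : Continuous fun x : ℝ => Real.exp (L * |x|)).aestronglyMeasurable
    (Filter.Eventually.of_forall fun x => ?_)
  rw [Real.norm_of_nonneg (Real.exp_pos _).le]
  exact Real.exp_le_exp.2 (mul_le_mul_of_nonneg_right (by linarith [le_abs_self L]) (abs_nonneg _))

theorem integrable_of_le_exp_abs {μ : Measure ℝ} {L A : ℝ}
    (hL : Integrable (fun x => Real.exp (L * |x|)) μ) {f : ℝ → ℝ} (hf : Measurable f)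
    (hb : ∀ x, |f x| ≤ A * Real.exp (L * |x|)) : Integrable f μ :=
  (hL.const_mul A).mono' hf.aestronglyMeasurable (Filter.Eventually.of_forall hb)

/-- The second moments of the measures of the class are uniformly bounded. -/
theorem exists_second_moment_bound (β m σ : ℝ) (hm : 0 < m) (hσ : 0 ≤ σ) (hβ : 0 ≤ β) :
    ∃ V : ℝ, 0 < V ∧ ∀ μ, MemClassM β m σ μ →
      Integrable (fun x => x ^ 2) μ ∧ ∫ x, x ^ 2 ∂μ ≤ V := by
  have hmb : 0 < m ^ β := Real.rpow_pos_of_pos hm _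
  have hs : 0 ≤ σ ^ (β + 1) := Real.rpow_nonneg hσ _
  -- The `+ 1` keeps the denominator positive when `σ = 0`.
  set L := m ^ β / (2 * σ ^ (β + 1) + 1) with hLdef
  have hL : 0 < L := by positivity
  have hLs : 2 * L * σ ^ (β + 1) ≤ m ^ β := by
    rw [hLdef, mul_div_assoc', div_mul_eq_mul_div, div_le_iff₀ (by positivity)]
    nlinarith
  refine ⟨2 / L ^ 2 * (5 * Real.exp (L * m)), by positivity, fun μ h => ?_⟩
  have hi := h.integrable_exp_abs hm hβ hL hLs
  have hb : ∀ x : ℝ, x ^ 2 ≤ 2 / L ^ 2 * Real.exp (L * |x|) := by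
    intro x
    have := Real.quadratic_le_exp_of_nonneg (x := L * |x|) (by positivity)
    have h2 : 0 ≤ L * |x| := by positivity
    rw [div_mul_eq_mul_div, le_div_iff₀ (by positivity), ← sq_abs x]
    nlinarith
  have hx : Integrable (fun x : ℝ => x ^ 2) μ :=
    integrable_of_le_exp_abs hi (by fun_prop) fun x => by rw [abs_of_nonneg (sq_nonneg x)]; exact hb x
  refine ⟨hx, (integral_mono hx (hi.const_mul _) hb).trans ?_⟩
  rw [integral_const_mul]
  gcongr
  rw [integral_eq_lintegral_of_nonneg_ae (Filter.Eventually.of_forall fun x => (Real.exp_pos _).le)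
    hi.1]
  exact ENNReal.toReal_le_of_le_ofReal (by positivity) (h.lintegral_exp_abs_le hm hβ hL hLs)

/-! ### The entropy potential and elementary bounds. -/

/-- The function `u ↦ u eᵘ - eᵘ + 1`, which controls the entropy of exponentials. -/
noncomputable def entPot (u : ℝ) : ℝ := u * Real.exp u - Real.exp u + 1

theorem continuous_entPot : Continuous entPot := by unfold entPot; fun_prop

theorem entPot_zero : entPot 0 = 0 := by simp [entPot]

theorem hasDerivAt_entPot (u : ℝ) : HasDerivAt entPot (u * Real.exp u) u := by
  have h := (((hasDerivAt_id u).mul (Real.hasDerivAt_exp u)).sub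
    (Real.hasDerivAt_exp u)).add_const 1
  exact h.congr_deriv (by simp)

/-- The derivative is `u (e^u - 1) ≥ 0`. Comparison with the value at `0` gives both quadratic
bounds that follow. -/
theorem monotone_entPot_sub : Monotone fun u => entPot u - u ^ 2 / 2 := by
  have hd : ∀ u : ℝ, HasDerivAt (fun u => entPot u - u ^ 2 / 2) (u * Real.exp u - u) u := by
    intro u
    have := (hasDerivAt_entPot u).sub (((hasDerivAt_id u).pow 2).div_const 2)
    exact this.congr_deriv (by simp)
  refine monotone_of_deriv_nonneg (fun u => (hd u).differentiableAt) fun u => ?_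
  rw [(hd u).deriv]
  rcases le_total 0 u with h | h
  · nlinarith [Real.one_le_exp h]
  · nlinarith [Real.exp_le_one_iff.2 h]

theorem entPot_le_sq_of_nonpos {u : ℝ} (hu : u ≤ 0) : entPot u ≤ u ^ 2 / 2 := by
  have := monotone_entPot_sub hu
  simp only [entPot_zero] at this
  linarith

theorem sq_le_entPot {u : ℝ} (hu : 0 ≤ u) : u ^ 2 / 2 ≤ entPot u := by
  have := monotone_entPot_sub hu
  simp only [entPot_zero] at this
  linarith

theorem entPot_nonneg (u : ℝ) : 0 ≤ entPot u := by
  have h := Real.add_one_le_exp (-u)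
  have h2 : Real.exp (-u) * Real.exp u = 1 := by rw [← Real.exp_add]; simp
  unfold entPot
  nlinarith [Real.exp_pos u]

theorem entPot_le {u : ℝ} (hu : 0 ≤ u) : entPot u ≤ u ^ 2 * Real.exp u := by
  have h := Real.add_one_le_exp u
  -- Since `(1 - u + u²)(1 + u) = 1 + u³`, this gives `(1 - u + u²) e^u ≥ 1`, which is the claim.
  have h2 : 0 ≤ (1 - u + u ^ 2) * (Real.exp u - (u + 1)) :=
    mul_nonneg (by nlinarith [sq_nonneg (u - 1)]) (by linarith)
  unfold entPot
  nlinarith [pow_nonneg hu 3]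

theorem sq_mul_exp_le_entPot {u : ℝ} (hu : 0 ≤ u) (hu1 : u ≤ 1) :
    u ^ 2 * Real.exp u / 6 ≤ entPot u := by
  have h1 : Real.exp u ≤ 3 :=
    (Real.exp_le_exp.2 hu1).trans (by linarith [Real.exp_one_lt_d9])
  nlinarith [sq_le_entPot hu, sq_nonneg u]

theorem mul_exp_le_entPot {u : ℝ} (hu1 : 1 ≤ u) : u * Real.exp u / 3 ≤ entPot u := by
  unfold entPot
  rcases le_or_gt (3 / 2) u with h | h
  · nlinarith [Real.exp_pos u]
  -- For `1 ≤ u < 3/2` the claim is `(3 - 2u) e^u ≤ 3`. It follows from `(2 - u) e^u ≤ e ≤ 3` and `3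
  -- - 2u ≤ 2 - u`.
  · have h1 := Real.add_one_le_exp (1 - u)
    have h2 : Real.exp (1 - u) * Real.exp u = Real.exp 1 := by rw [← Real.exp_add]; simp
    have h3 := Real.exp_one_lt_d9
    have h4 : (2 - u) * Real.exp u ≤ 3 := by nlinarith [Real.exp_pos u]
    have h5 : (3 - 2 * u) * ((2 - u) * Real.exp u) ≤ (3 - 2 * u) * 3 :=
      mul_le_mul_of_nonneg_left h4 (by linarith)
    have h6 : (2 - u) * ((3 - 2 * u) * Real.exp u) ≤ (2 - u) * 3 := by nlinarith
    have := le_of_mul_le_mul_left h6 (by linarith)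
    linarith

/-- The positive part creates no kink because the derivative of `entPot` vanishes at `0`. -/
theorem hasDerivAt_entPot_max (s : ℝ) :
    HasDerivAt (fun s => entPot (max s 0)) (max s 0 * Real.exp s) s := by
  rcases lt_trichotomy s 0 with h | h | h
  · rw [max_eq_right h.le, zero_mul]
    refine (hasDerivAt_const s (0 : ℝ)).congr_of_eventuallyEq ?_
    filter_upwards [Iio_mem_nhds h] with x hx
    rw [max_eq_right (le_of_lt hx), entPot_zero]
  · subst h
    have h1 : HasDerivWithinAt (fun s => entPot (max s 0)) 0 (Set.Iic 0) 0 :=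
      (hasDerivWithinAt_const (0 : ℝ) (Set.Iic 0) (0 : ℝ)).congr
        (fun x hx => by rw [max_eq_right hx, entPot_zero]) (by simp [entPot_zero])
    have h2 : HasDerivWithinAt (fun s => entPot (max s 0)) 0 (Set.Ici 0) 0 := by
      have := (hasDerivAt_entPot 0).hasDerivWithinAt (s := Set.Ici 0)
      rw [zero_mul] at this
      exact this.congr (fun x hx => by rw [max_eq_left hx]) (by simp)
    have := h1.union h2
    rw [Set.Iic_union_Ici, hasDerivWithinAt_univ] at this
    simpa using this
  · rw [max_eq_left h.le]
    refine (hasDerivAt_entPot s).congr_of_eventuallyEq ?_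
    filter_upwards [Ioi_mem_nhds h] with x hx
    rw [max_eq_left (le_of_lt hx)]

theorem exp_mul_entPot_sub (c u : ℝ) : Real.exp c * entPot (u - c) =
    u * Real.exp u - (c + 1) * Real.exp u + Real.exp c := by
  have : Real.exp c * Real.exp (u - c) = Real.exp u := by rw [← Real.exp_add]; simp
  unfold entPot
  linear_combination (u - c - 1) * this

/-- Variational bound for the entropy. -/
theorem entropy_exp_le {α : Type*} [MeasurableSpace α] {μ : Measure α} [IsProbabilityMeasure μ]
    {f : α → ℝ} (h1 : Integrable (fun x => f x * Real.exp (f x)) μ)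
    (h2 : Integrable (fun x => Real.exp (f x)) μ) (c : ℝ) :
    ∫ x, f x * Real.exp (f x) ∂μ - (∫ x, Real.exp (f x) ∂μ) * Real.log (∫ x, Real.exp (f x) ∂μ) ≤
      ∫ x, Real.exp c * entPot (f x - c) ∂μ := by
  simp_rw [exp_mul_entPot_sub]
  have h12 : Integrable (fun x => f x * Real.exp (f x) - (c + 1) * Real.exp (f x)) μ :=
    h1.sub (h2.const_mul _)
  rw [integral_add h12 (integrable_const _), integral_sub h1 (h2.const_mul _), integral_const_mul]
  have ha : 0 < ∫ x, Real.exp (f x) ∂μ := integral_exp_pos h2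
  set a := ∫ x, Real.exp (f x) ∂μ
  -- Multiplied by `a`, this is the tangent bound `a log a ≥ (c + 1) a - e^c`, with equality at `c =
  -- log a`.
  have h3 := Real.add_one_le_exp (c - Real.log a)
  rw [Real.exp_sub, Real.exp_log ha, le_div_iff₀ ha] at h3
  simp
  linarith

/-! ### The modified log-Sobolev inequality on the line. -/

theorem convex_tangent {φ : ℝ → ℝ} (hc : ConvexOn ℝ Set.univ φ) (hd : Differentiable ℝ φ)
    (x y : ℝ) : φ x + deriv φ x * (y - x) ≤ φ y := by
  rcases lt_trichotomy x y with h | h | h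
  · have := hc.deriv_le_slope (Set.mem_univ x) (Set.mem_univ y) h (hd x)
    rw [slope_def_field, le_div_iff₀ (by linarith)] at this
    linarith
  · simp [h]
  · have := hc.slope_le_deriv (Set.mem_univ y) (Set.mem_univ x) h (hd x)
    rw [slope_def_field, div_le_iff₀ (by linarith)] at this
    linarith

/-- An integrated form of the defining property of the class for `entPot ((φ - φ M)⁺)`. -/
theorem MemClassM.right_tail_entPot {β m σ L B M : ℝ} {μ : Measure ℝ} (h : MemClassM β m σ μ)
    (hβ0 : 0 ≤ β) (hβ1 : β ≤ 1) (hσ : 0 ≤ σ) (hm : 0 < m) {D : ℝ → ℝ} (hD : ∀ d, d ^ 2 ≤ D d)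
    (hB : 0 ≤ B)
    (habs : ∀ u d, 0 ≤ u → 0 ≤ d → d ≤ L → 2 ^ β * σ ^ (β + 1) * (u ^ (1 - β) * d ^ (1 + β)) *
      Real.exp u ≤ entPot u / 2 + B * D d * Real.exp u)
    {φ : ℝ → ℝ} (hφ : ContDiff ℝ 1 φ) (hc : ConvexOn ℝ Set.univ φ) (hL : ∀ x, |deriv φ x| ≤ L)
    (hM : |M| + 1 ≤ m)
    (hi1 : Integrable (fun x => entPot (max (φ x - φ M) 0)) μ)
    (hi2 : Integrable (fun x => D (deriv φ x) * Real.exp (φ x - φ M)) μ) :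
    ∫ x in Set.Ici m, entPot (max (φ x - φ M) 0) ∂μ ≤
      2 * (4 * m ^ 2 + B) * ∫ x in Set.Ici m, D (deriv φ x) * Real.exp (φ x - φ M) ∂μ := by
  have := h.1
  have hd : Differentiable ℝ φ := hφ.differentiable (by norm_num)
  have hd' : Continuous (deriv φ) := hφ.continuous_deriv (by norm_num)
  have hcont : Continuous φ := hφ.continuous
  have htan := convex_tangent hc hd
  have hmono : Monotone (deriv φ) := fun x y hxy =>
    hc.monotoneOn_deriv (fun x _ => hd x) (Set.mem_univ x) (Set.mem_univ y) hxy
  have hM1 : M + 1 ≤ m := by linarith [le_abs_self M]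
  have hM2 : -m ≤ M := by linarith [neg_abs_le M]
  have hD0 : ∀ d, 0 ≤ D d := fun d => (sq_nonneg d).trans (hD d)
  set c := φ M with hcdef
  set k : ℝ → ℝ := fun y => max (φ y - c) 0 * deriv φ y * Real.exp (φ y - c) with hk
  -- The maximum with `1` only ensures continuity on the whole line: for `y ≥ m` one has `y - M ≥
  -- 1`.
  set g : ℝ → ℝ := fun y => k y / (max (y - M) 1) ^ β with hg
  have hup : ∀ x, φ x - c ≤ deriv φ x * (x - M) := fun x => by linarith [htan x M]
  have hpos : ∀ x, m ≤ x → c < φ x → 0 < deriv φ x := fun x hx hcx =>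
    pos_of_mul_pos_left (b := x - M) (by linarith [hup x]) (by linarith)
  have hk0 : ∀ y, m ≤ y → 0 ≤ k y := by
    intro y hy
    rcases le_or_gt (φ y) c with h1 | h1
    · simp [hk, max_eq_right (sub_nonpos.2 h1)]
    · have := hpos y hy h1
      exact mul_nonneg (mul_nonneg (le_max_right _ _) this.le) (Real.exp_pos _).le
  have hkc : Continuous k := by fun_prop
  have hgc : Continuous g := hkc.div
    (Continuous.rpow_const (by fun_prop) fun x => Or.inr hβ0)
    fun x => (Real.rpow_pos_of_pos (by positivity) _).ne'
  have hg0 : ∀ y, m ≤ y → 0 ≤ g y := fun y hy => div_nonneg (hk0 y hy) (by positivity)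
  have hgm : MonotoneOn g (Set.Ici m) := by
    intro x hx y hy hxy
    have hx : m ≤ x := hx
    have hy : m ≤ y := hy
    rcases le_or_gt (φ x) c with h1 | h1
    · refine le_trans (le_of_eq ?_) (hg0 y hy)
      simp [hg, hk, max_eq_right (sub_nonpos.2 h1)]
    · have hpx := hpos x hx h1
      have hpy := hmono hxy
      have hφxy : φ x ≤ φ y := by nlinarith [htan x y, mul_nonneg hpx.le (sub_nonneg.2 hxy)]
      -- Each factor is nonnegative and nondecreasing once `φ` exceeds `c`: the secant slope from
      -- `M` and `φ'` by convexity, the power because `β ≤ 1`.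
      have form : ∀ z, m ≤ z → c ≤ φ z → g z =
          (φ z - c) / (z - M) * (z - M) ^ (1 - β) * deriv φ z * Real.exp (φ z - c) := by
        intro z hz hcz
        have hz0 : 0 < z - M := by linarith
        simp only [hg, hk]
        rw [max_eq_left (by linarith), max_eq_left (by linarith), Real.rpow_sub hz0,
          Real.rpow_one]
        field_simp
      rw [form x hx h1.le, form y hy (h1.le.trans hφxy)]
      have hsec := hc.secant_mono (Set.mem_univ M) (Set.mem_univ x) (Set.mem_univ y)
        (by linarith) (by linarith) hxy
      have hx0 : 0 < x - M := by linarith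
      have hy0 : 0 < y - M := by linarith
      have e1 : 0 ≤ (φ x - c) / (x - M) := div_nonneg (by linarith) hx0.le
      have e2 : 0 ≤ (φ y - c) / (y - M) := div_nonneg (by linarith) hy0.le
      have e3 : (x - M) ^ (1 - β) ≤ (y - M) ^ (1 - β) :=
        Real.rpow_le_rpow hx0.le (by linarith) (by linarith)
      have e4 : 0 ≤ deriv φ y := hpx.le.trans hpy
      gcongr
  have hT := h.lintegral_lintegral_le hm.le hgc hg0 hgm
  set H : ℝ → ℝ := fun x => entPot (max (φ x - c) 0) with hH
  have hH0 : ∀ x, 0 ≤ H x := fun x => entPot_nonneg _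
  set E : ℝ → ℝ := fun x => D (deriv φ x) * Real.exp (φ x - c) with hE
  have hE0 : ∀ x, 0 ≤ E x := fun x => mul_nonneg (hD0 _) (Real.exp_pos _).le
  -- Fundamental theorem of calculus for `H`, whose derivative is `k`. As `y - M ≤ 2y`, `k = (y -
  -- M)^β g ≤ 2^β y^β g`.
  have pt1 : ∀ x, m ≤ x → ENNReal.ofReal (H x) ≤ ENNReal.ofReal (H m) +
      ENNReal.ofReal (2 ^ β) * ∫⁻ y in Set.Icc m x, ENNReal.ofReal (y ^ β * g y) := by
    intro x hx
    have h1 : H x = H m + ∫ y in m..x, k y := by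
      have : ∀ y ∈ Set.uIcc m x, HasDerivAt H (k y) y := by
        intro y _
        have := (hasDerivAt_entPot_max (φ y - c)).comp y ((hd y).hasDerivAt.sub_const c)
        refine this.congr_deriv ?_
        simp only [hk]; ring
      rw [intervalIntegral.integral_eq_sub_of_hasDerivAt this (hkc.intervalIntegrable _ _)]
      ring
    rw [h1, ENNReal.ofReal_add (hH0 m)
      (intervalIntegral.integral_nonneg hx fun y hy => hk0 y hy.1)]
    gcongr
    rw [intervalIntegral.integral_of_le hx, ofReal_integral_eq_lintegral_ofReal
      (hkc.intervalIntegrable _ _).1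
      ((ae_restrict_iff' measurableSet_Ioc).2
        (Filter.Eventually.of_forall fun y hy => hk0 y hy.1.le)),
      ← lintegral_const_mul' _ _ ENNReal.ofReal_ne_top]
    refine le_trans (setLIntegral_mono' measurableSet_Ioc fun y hy => ?_)
      (lintegral_mono_set Set.Ioc_subset_Icc_self)
    rw [← ENNReal.ofReal_mul (by positivity)]
    refine ENNReal.ofReal_le_ofReal ?_
    have hy1 : m < y := hy.1
    have hyM : 1 ≤ y - M := by linarith
    have hy0 : 0 < y := hm.trans hy1
    have hr : 0 < (y - M) ^ β := Real.rpow_pos_of_pos (by linarith) _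
    simp only [hg, max_eq_left hyM]
    rw [mul_div_assoc', mul_div_assoc', le_div_iff₀ hr, ← mul_assoc,
      ← Real.mul_rpow (by norm_num) hy0.le, mul_comm]
    exact mul_le_mul_of_nonneg_right (Real.rpow_le_rpow (by linarith) (by linarith) hβ0)
      (hk0 y hy1.le)
  -- Writing `u = φ x - c` and `d = φ' x`, the tangent bound `u ≤ d (x - M)` gives `g ≤ u^(1-β)
  -- d^(1+β) e^u`, the quantity handled by `habs`.
  have pt2 : ∀ x, m ≤ x → 2 ^ β * σ ^ (β + 1) * g x ≤ H x / 2 + B * E x := by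
    intro x hx
    rcases le_or_gt (φ x) c with h1 | h1
    · have : g x = 0 := by simp [hg, hk, max_eq_right (sub_nonpos.2 h1)]
      rw [this, mul_zero]
      have := hH0 x
      have := mul_nonneg hB (hE0 x)
      linarith
    · have hpx := hpos x hx h1
      have hx0 : 0 < x - M := by linarith
      have hu0 : 0 < φ x - c := by linarith
      have habs' := habs (φ x - c) (deriv φ x) hu0.le hpx.le ((le_abs_self _).trans (hL x))
      simp only [hH, hE, max_eq_left hu0.le]
      refine le_trans ?_ (habs'.trans (le_of_eq (by ring)))
      rw [mul_assoc _ _ (Real.exp _)]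
      refine mul_le_mul_of_nonneg_left ?_ (by positivity)
      have hle : (φ x - c) ^ β ≤ deriv φ x ^ β * (x - M) ^ β := by
        rw [← Real.mul_rpow hpx.le hx0.le]
        exact Real.rpow_le_rpow hu0.le (hup x) hβ0
      simp only [hg, hk, max_eq_left hu0.le]
      rw [max_eq_left (by linarith), div_le_iff₀ (Real.rpow_pos_of_pos hx0 _)]
      have s1 : (φ x - c) = (φ x - c) ^ (1 - β) * (φ x - c) ^ β := by
        rw [← Real.rpow_add hu0]; simp
      have s2 : deriv φ x ^ (1 + β) = deriv φ x * deriv φ x ^ β := by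
        rw [Real.rpow_add hpx, Real.rpow_one]
      rw [s2]
      calc (φ x - c) * deriv φ x * Real.exp (φ x - c)
          = (φ x - c) ^ (1 - β) * deriv φ x * Real.exp (φ x - c) * (φ x - c) ^ β := by
            nth_rw 1 [s1]; ring
        _ ≤ (φ x - c) ^ (1 - β) * deriv φ x * Real.exp (φ x - c) *
            (deriv φ x ^ β * (x - M) ^ β) := by gcongr
        _ = _ := by ring
  -- The boundary value `H m` is compared with `E` at every `x ≥ m`, so it can be integrated over
  -- the whole tail; `φ'` and, when `H m ≠ 0`, `φ` are larger at `x` than at `m`.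
  have pt3 : ∀ x, m ≤ x → H m ≤ 4 * m ^ 2 * E x := by
    intro x hx
    rcases le_or_gt (φ m) c with h1 | h1
    · simp only [hH, max_eq_right (sub_nonpos.2 h1), entPot_zero]
      have := hE0 x
      positivity
    · have hpm := hpos m le_rfl h1
      have hpx := hmono hx
      have hφ' : φ m ≤ φ x := by nlinarith [htan m x, mul_nonneg hpm.le (sub_nonneg.2 hx)]
      have hu0 : 0 < φ m - c := by linarith
      simp only [hH, max_eq_left hu0.le]
      calc entPot (φ m - c) ≤ (φ m - c) ^ 2 * Real.exp (φ m - c) := entPot_le hu0.le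
        _ ≤ (deriv φ x * (2 * m)) ^ 2 * Real.exp (φ x - c) := by
            gcongr
            calc φ m - c ≤ deriv φ m * (m - M) := hup m
              _ ≤ _ := by gcongr <;> linarith
        _ = 4 * m ^ 2 * (deriv φ x ^ 2 * Real.exp (φ x - c)) := by ring
        _ ≤ _ := by simp only [hE]; gcongr; exact hD _
  have hiH := hi1.restrict (s := Set.Ici m)
  have hiE := hi2.restrict (s := Set.Ici m)
  have hI : Integrable (fun x => H x / 2 + (4 * m ^ 2 + B) * E x) (μ.restrict (Set.Ici m)) :=
    (hiH.div_const 2).add (hiE.const_mul _)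
  have hnn : ∀ x, 0 ≤ H x / 2 + (4 * m ^ 2 + B) * E x := fun x =>
    add_nonneg (by linarith [hH0 x]) (mul_nonneg (by positivity) (hE0 x))
  have main : ENNReal.ofReal (∫ x in Set.Ici m, H x ∂μ) ≤
      ENNReal.ofReal (∫ x in Set.Ici m, (H x / 2 + (4 * m ^ 2 + B) * E x) ∂μ) := by
    rw [ofReal_integral_eq_lintegral_ofReal hiH (Filter.Eventually.of_forall hH0),
      ofReal_integral_eq_lintegral_ofReal hI (Filter.Eventually.of_forall hnn)]
    calc ∫⁻ x in Set.Ici m, ENNReal.ofReal (H x) ∂μ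
        ≤ ∫⁻ x in Set.Ici m, (ENNReal.ofReal (H m) + ENNReal.ofReal (2 ^ β) *
            ∫⁻ y in Set.Icc m x, ENNReal.ofReal (y ^ β * g y)) ∂μ :=
          setLIntegral_mono' measurableSet_Ici pt1
      _ = ∫⁻ _ in Set.Ici m, ENNReal.ofReal (H m) ∂μ + ENNReal.ofReal (2 ^ β) *
            ∫⁻ x in Set.Ici m, (∫⁻ y in Set.Icc m x, ENNReal.ofReal (y ^ β * g y)) ∂μ := by
          rw [lintegral_add_left measurable_const,
            lintegral_const_mul' _ _ ENNReal.ofReal_ne_top]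
      _ ≤ ∫⁻ _ in Set.Ici m, ENNReal.ofReal (H m) ∂μ + ENNReal.ofReal (2 ^ β) *
            (ENNReal.ofReal (σ ^ (β + 1)) * ∫⁻ x in Set.Ici m, ENNReal.ofReal (g x) ∂μ) := by
          gcongr
      _ = ∫⁻ x in Set.Ici m, (ENNReal.ofReal (H m) +
            ENNReal.ofReal (2 ^ β * σ ^ (β + 1) * g x)) ∂μ := by
          rw [lintegral_add_left measurable_const, ← mul_assoc,
            ← ENNReal.ofReal_mul (by positivity),
            ← lintegral_const_mul' _ _ ENNReal.ofReal_ne_top]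
          congr 1
          refine lintegral_congr fun x => ?_
          rw [← ENNReal.ofReal_mul (by positivity)]
      _ ≤ _ := by
          refine setLIntegral_mono' measurableSet_Ici fun x hx => ?_
          rw [← ENNReal.ofReal_add (hH0 m) (mul_nonneg (by positivity) (hg0 x hx))]
          exact ENNReal.ofReal_le_ofReal (by linarith [pt2 x hx, pt3 x hx])
  rw [ENNReal.ofReal_le_ofReal_iff (integral_nonneg hnn),
    integral_add (hiH.div_const 2) (hiE.const_mul _), integral_div, integral_const_mul] at main
  linarith

/-- The reflected form of `MemClassM.right_tail_entPot`. -/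
theorem MemClassM.left_tail_entPot {β m σ L B M : ℝ} {μ : Measure ℝ} (h : MemClassM β m σ μ)
    (hβ0 : 0 ≤ β) (hβ1 : β ≤ 1) (hσ : 0 ≤ σ) (hm : 0 < m) {D : ℝ → ℝ} (hD : ∀ d, d ^ 2 ≤ D d)
    (hDn : ∀ d, D (-d) = D d) (hB : 0 ≤ B)
    (habs : ∀ u d, 0 ≤ u → 0 ≤ d → d ≤ L → 2 ^ β * σ ^ (β + 1) * (u ^ (1 - β) * d ^ (1 + β)) *
      Real.exp u ≤ entPot u / 2 + B * D d * Real.exp u)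
    {φ : ℝ → ℝ} (hφ : ContDiff ℝ 1 φ) (hc : ConvexOn ℝ Set.univ φ) (hL : ∀ x, |deriv φ x| ≤ L)
    (hM : |M| + 1 ≤ m)
    (hi1 : Integrable (fun x => entPot (max (φ x - φ M) 0)) μ)
    (hi2 : Integrable (fun x => D (deriv φ x) * Real.exp (φ x - φ M)) μ) :
    ∫ x in Set.Iic (-m), entPot (max (φ x - φ M) 0) ∂μ ≤
      2 * (4 * m ^ 2 + B) *
        ∫ x in Set.Iic (-m), D (deriv φ x) * Real.exp (φ x - φ M) ∂μ := by
  have hψd : ∀ x, deriv (fun x => φ (-x)) x = -deriv φ (-x) := fun x => deriv_comp_neg φ x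
  have hψc : ConvexOn ℝ Set.univ fun x => φ (-x) := by
    have := hc.comp_linearMap (-LinearMap.id)
    simpa [Function.comp_def] using this
  have hψ : ContDiff ℝ 1 fun x => φ (-x) := hφ.comp contDiff_neg
  have hmn : MeasurableEmbedding (Neg.neg : ℝ → ℝ) := (MeasurableEquiv.neg ℝ).measurableEmbedding
  have hiψ1 : Integrable (fun x => entPot (max (φ (-x) - φ (- -M)) 0)) (μ.map Neg.neg) := by
    rw [hmn.integrable_map_iff]
    simpa [Function.comp_def] using hi1
  have hiψ2 : Integrable (fun x => D (deriv (fun x => φ (-x)) x) *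
      Real.exp (φ (-x) - φ (- -M))) (μ.map Neg.neg) := by
    rw [hmn.integrable_map_iff]
    simp only [Function.comp_def, hψd, hDn]
    simpa using hi2
  have := (h.map_neg hm.le).right_tail_entPot hβ0 hβ1 hσ hm hD hB habs hψ hψc
    (fun x => by rw [hψd, abs_neg]; exact hL _) (M := -M) (by rwa [abs_neg]) hiψ1 hiψ2
  rw [hmn.setIntegral_map, hmn.setIntegral_map] at this
  simp only [hψd, hDn, neg_neg] at this
  rwa [show (Neg.neg ⁻¹' Set.Ici m : Set ℝ) = Set.Iic (-m) by simp] at this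

/-- Chebyshev's inequality. -/
theorem half_le_measureReal_Icc {μ : Measure ℝ} [IsProbabilityMeasure μ] {V R : ℝ}
    (hi : Integrable (fun x => x ^ 2) μ) (hv : ∫ x, x ^ 2 ∂μ ≤ V) (hR : 0 < R)
    (hVR : 2 * V ≤ R ^ 2) : 1 / 2 ≤ μ.real (Set.Icc (-R) R) := by
  have h1 := mul_meas_ge_le_integral_of_nonneg (μ := μ) (f := fun x : ℝ => x ^ 2)
    (Filter.Eventually.of_forall fun x => sq_nonneg x) hi (R ^ 2)
  have h2 : μ.real (Set.Icc (-R) R)ᶜ ≤ μ.real {x | R ^ 2 ≤ x ^ 2} := by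
    refine measureReal_mono fun x hx => ?_
    have : R < |x| := by
      by_contra hcon
      exact hx ⟨(abs_le.1 (not_lt.1 hcon)).1, (abs_le.1 (not_lt.1 hcon)).2⟩
    have h3 := sq_abs x
    simp only [Set.mem_ofPred_eq]
    nlinarith
  rw [probReal_compl_eq_one_sub measurableSet_Icc] at h2
  have h4 : R ^ 2 * μ.real {x | R ^ 2 ≤ x ^ 2} ≤ R ^ 2 * (1 / 2) := by linarith
  have := le_of_mul_le_mul_left h4 (by positivity)
  linarith

/-- The point `M` minimises `φ` on `[-R, R]`. At an endpoint minimum `φ'^2 e^φ` is also least there,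
and averaging over the interval loses at most a factor `2`; at an interior minimum the left side
vanishes. -/
theorem exists_base_point {μ : Measure ℝ} [IsProbabilityMeasure μ] {R : ℝ} (hR : 0 < R)
    (hμ : 1 / 2 ≤ μ.real (Set.Icc (-R) R)) {φ : ℝ → ℝ} (hφ : ContDiff ℝ 1 φ)
    (hc : ConvexOn ℝ Set.univ φ)
    (hi : Integrable (fun x => deriv φ x ^ 2 * Real.exp (φ x)) μ) :
    ∃ M, |M| ≤ R ∧ Real.exp (φ M) * deriv φ M ^ 2 ≤
      2 * ∫ x, deriv φ x ^ 2 * Real.exp (φ x) ∂μ := by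
  have hd : Differentiable ℝ φ := hφ.differentiable (by norm_num)
  have hd' : Continuous (deriv φ) := hφ.continuous_deriv (by norm_num)
  have htan := convex_tangent hc hd
  have hmono : Monotone (deriv φ) := fun x y hxy =>
    hc.monotoneOn_deriv (fun x _ => hd x) (Set.mem_univ x) (Set.mem_univ y) hxy
  have key : ∀ M, (∀ x ∈ Set.Icc (-R) R,
      Real.exp (φ M) * deriv φ M ^ 2 ≤ deriv φ x ^ 2 * Real.exp (φ x)) →
      Real.exp (φ M) * deriv φ M ^ 2 ≤ 2 * ∫ x, deriv φ x ^ 2 * Real.exp (φ x) ∂μ := by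
    intro M hM
    have h1 : ∫ x, (Set.Icc (-R) R).indicator (fun _ => Real.exp (φ M) * deriv φ M ^ 2) x ∂μ ≤
        ∫ x, deriv φ x ^ 2 * Real.exp (φ x) ∂μ := by
      refine integral_mono ((integrable_const _).indicator measurableSet_Icc) hi fun x => ?_
      refine Set.indicator_apply_le' (hM x) fun _ => by positivity
    rw [integral_indicator_const _ measurableSet_Icc, smul_eq_mul] at h1
    have h2 : 0 ≤ Real.exp (φ M) * deriv φ M ^ 2 := by positivity
    nlinarith
  by_cases h1 : 0 ≤ deriv φ (-R)
  · refine ⟨-R, by rw [abs_neg, abs_of_pos hR], key _ fun x hx => ?_⟩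
    have e1 := hmono hx.1
    have e2 : φ (-R) ≤ φ x := by
      nlinarith [htan (-R) x, mul_nonneg h1 (sub_nonneg.2 hx.1)]
    rw [mul_comm]
    gcongr
  by_cases h2 : deriv φ R ≤ 0
  · refine ⟨R, by rw [abs_of_pos hR], key _ fun x hx => ?_⟩
    have e1 := hmono hx.2
    have e2 : φ R ≤ φ x := by
      nlinarith [htan R x, mul_nonneg (neg_nonneg.2 h2) (sub_nonneg.2 hx.2)]
    have e3 : deriv φ R ^ 2 ≤ deriv φ x ^ 2 := by nlinarith
    rw [mul_comm]
    gcongr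
  obtain ⟨M, hM, hM0⟩ := intermediate_value_Icc (show -R ≤ R by linarith)
    (f := deriv φ) hd'.continuousOn ⟨(not_le.1 h1).le, (not_le.1 h2).le⟩
  refine ⟨M, abs_le.2 hM, key M fun x _ => ?_⟩
  rw [hM0]
  simp
  positivity

theorem abs_deriv_le_of_lipschitz {φ : ℝ → ℝ} {L : ℝ} (hL : 0 ≤ L)
    (h : ∀ x y, |φ x - φ y| ≤ L * |x - y|) (x : ℝ) : |deriv φ x| ≤ L := by
  have : LipschitzWith ⟨L, hL⟩ φ := LipschitzWith.of_dist_le_mul fun x y => by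
    rw [Real.dist_eq, Real.dist_eq]
    exact h x y
  exact norm_deriv_le_of_lipschitz this

set_option maxHeartbeats 1000000 in
/-- The modified log-Sobolev inequality on the line. -/
theorem MemClassM.entropy_exp_le_integral {β m σ L B R V : ℝ} {μ : Measure ℝ}
    (h : MemClassM β m σ μ)
    (hβ0 : 0 ≤ β) (hβ1 : β ≤ 1) (hσ : 0 ≤ σ) (hm : 0 < m) {D : ℝ → ℝ} (hD : ∀ d, d ^ 2 ≤ D d)
    (hDc : Continuous D) (hDn : ∀ d, D (-d) = D d)
    (hB : 0 ≤ B) (hR : 0 < R) (hVR : 2 * V ≤ R ^ 2) (hRm : R + 1 ≤ m)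
    (hx2 : Integrable (fun x => x ^ 2) μ) (hxV : ∫ x, x ^ 2 ∂μ ≤ V)
    (habs : ∀ u d, 0 ≤ u → 0 ≤ d → d ≤ L → 2 ^ β * σ ^ (β + 1) * (u ^ (1 - β) * d ^ (1 + β)) *
      Real.exp u ≤ entPot u / 2 + B * D d * Real.exp u)
    (hL : 0 < L) (hexp : Integrable (fun x => Real.exp (2 * L * |x|)) μ)
    {φ : ℝ → ℝ} (hφ : ContDiff ℝ 1 φ) (hc : ConvexOn ℝ Set.univ φ)
    (hlip : ∀ x y, |φ x - φ y| ≤ L * |x - y|) :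
    ∫ x, φ x * Real.exp (φ x) ∂μ -
        (∫ x, Real.exp (φ x) ∂μ) * Real.log (∫ x, Real.exp (φ x) ∂μ) ≤
      (2 * (V + R ^ 2) + 4 * m ^ 2 + 4 * (4 * m ^ 2 + B)) *
        ∫ x, D (deriv φ x) * Real.exp (φ x) ∂μ := by
  have := h.1
  have hd : Differentiable ℝ φ := hφ.differentiable (by norm_num)
  have hd' : Continuous (deriv φ) := hφ.continuous_deriv (by norm_num)
  have hcont : Continuous φ := hφ.continuous
  have htan := convex_tangent hc hd
  have hLd := abs_deriv_le_of_lipschitz hL.le hlip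
  have hD0 : ∀ d, 0 ≤ D d := fun d => (sq_nonneg d).trans (hD d)
  obtain ⟨K, hK⟩ : ∃ K, ∀ d ∈ Set.Icc (-L) L, ‖D d‖ ≤ K :=
    isCompact_Icc.exists_bound_of_continuousOn hDc.continuousOn
  -- The derivative stays in the compact interval `[-L, L]`, so the cost is bounded and only the
  -- integrability of `e^φ` matters.
  have hKd : ∀ x, D (deriv φ x) ≤ K := fun x =>
    (le_abs_self _).trans (hK _ (abs_le.1 (hLd x)))
  have hφb : ∀ x, |φ x| ≤ |φ 0| + L * |x| := fun x => by
    have h1 := hlip x 0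
    have h2 := abs_sub_abs_le_abs_sub (φ x) (φ 0)
    rw [sub_zero] at h1
    linarith
  have gexp : ∀ x, Real.exp (φ x) ≤ Real.exp |φ 0| * Real.exp (2 * L * |x|) := fun x => by
    rw [← Real.exp_add]
    refine Real.exp_le_exp.2 ?_
    have := hφb x
    have := le_abs_self (φ x)
    have : 0 ≤ L * |x| := by positivity
    linarith
  have gmul : ∀ x, |φ x| * Real.exp (φ x) ≤ Real.exp |φ 0| * (|φ 0| + 1) *
      Real.exp (2 * L * |x|) := fun x => by
    have h0 : 0 ≤ L * |x| := by positivity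
    have h1 := hφb x
    have h2 : Real.exp (φ x) ≤ Real.exp |φ 0| * Real.exp (L * |x|) := by
      rw [← Real.exp_add]
      exact Real.exp_le_exp.2 ((le_abs_self _).trans h1)
    have h3 : |φ x| ≤ (|φ 0| + 1) * Real.exp (L * |x|) := by
      nlinarith [Real.add_one_le_exp (L * |x|), abs_nonneg (φ 0)]
    calc |φ x| * Real.exp (φ x) ≤ ((|φ 0| + 1) * Real.exp (L * |x|)) *
          (Real.exp |φ 0| * Real.exp (L * |x|)) := by gcongr
      _ = Real.exp |φ 0| * (|φ 0| + 1) * (Real.exp (L * |x|) * Real.exp (L * |x|)) := by ring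
      _ = _ := by rw [← Real.exp_add]; ring_nf
  have iexp : Integrable (fun x => Real.exp (φ x)) μ :=
    integrable_of_le_exp_abs hexp (by fun_prop) fun x => by
      rw [abs_of_pos (Real.exp_pos _)]; exact gexp x
  have imul : Integrable (fun x => φ x * Real.exp (φ x)) μ :=
    integrable_of_le_exp_abs hexp (by fun_prop) fun x => by
      rw [abs_mul, abs_of_pos (Real.exp_pos (φ x))]; exact gmul x
  have iD : Integrable (fun x => D (deriv φ x) * Real.exp (φ x)) μ := by
    refine (iexp.const_mul K).mono' (by fun_prop) (Filter.Eventually.of_forall fun x => ?_)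
    rw [Real.norm_of_nonneg (mul_nonneg (hD0 _) (Real.exp_pos _).le)]
    exact mul_le_mul_of_nonneg_right (hKd x) (Real.exp_pos _).le
  have isq : Integrable (fun x => deriv φ x ^ 2 * Real.exp (φ x)) μ := by
    refine iD.mono' (by fun_prop) (Filter.Eventually.of_forall fun x => ?_)
    rw [Real.norm_of_nonneg (by positivity)]
    exact mul_le_mul_of_nonneg_right (hD _) (Real.exp_pos _).le
  obtain ⟨M, hMR, hMle⟩ := exists_base_point hR
    (half_le_measureReal_Icc hx2 hxV hR hVR) hφ hc isq
  have hMm : |M| + 1 ≤ m := by linarith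
  have hM1 : M + 1 ≤ m := by linarith [le_abs_self M]
  have hM2 : -m ≤ M - 1 := by linarith [neg_abs_le M]
  set c := φ M with hcdef
  have hec : Real.exp c * Real.exp (-c) = 1 := by rw [← Real.exp_add]; simp
  have hsub : ∀ x, Real.exp (φ x - c) = Real.exp (-c) * Real.exp (φ x) := fun x => by
    rw [← Real.exp_add]; ring_nf
  have hup : ∀ x, φ x - c ≤ deriv φ x * (x - M) := fun x => by linarith [htan x M]
  have iD' : Integrable (fun x => D (deriv φ x) * Real.exp (φ x - c)) μ := by
    refine (iD.const_mul (Real.exp (-c))).congr (Filter.Eventually.of_forall fun x => ?_)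
    simp only [hsub]; ring
  set H : ℝ → ℝ := fun x => entPot (max (φ x - c) 0) with hH
  have hH0 : ∀ x, 0 ≤ H x := fun x => entPot_nonneg _
  have iH0 : Integrable (fun x => entPot (φ x - c)) μ := by
    have : Integrable (fun x => Real.exp (-c) *
        (φ x * Real.exp (φ x) - (c + 1) * Real.exp (φ x) + Real.exp c)) μ :=
      ((imul.sub (iexp.const_mul _)).add (integrable_const _)).const_mul _
    refine this.congr (Filter.Eventually.of_forall fun x => ?_)
    simp only
    rw [← exp_mul_entPot_sub, ← mul_assoc, mul_comm (Real.exp (-c)), hec, one_mul]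
  have iH : Integrable H μ := by
    refine iH0.mono' (continuous_entPot.comp (by fun_prop)).aestronglyMeasurable
      (Filter.Eventually.of_forall fun x => ?_)
    rw [Real.norm_of_nonneg (hH0 x)]
    rcases le_total (φ x - c) 0 with h1 | h1
    · simp only [hH, max_eq_right h1, entPot_zero]; exact entPot_nonneg _
    · simp only [hH, max_eq_left h1]; exact le_rfl
  have tR : ∫ x in Set.Ici m, H x ∂μ ≤ 2 * (4 * m ^ 2 + B) *
      (Real.exp (-c) * ∫ x, D (deriv φ x) * Real.exp (φ x) ∂μ) := by
    refine (h.right_tail_entPot hβ0 hβ1 hσ hm hD hB habs hφ hc hLd hMm iH iD').trans ?_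
    gcongr
    rw [← integral_const_mul]
    refine (setIntegral_le_integral iD' (Filter.Eventually.of_forall fun x =>
      mul_nonneg (hD0 _) (Real.exp_pos _).le)).trans (le_of_eq ?_)
    refine integral_congr_ae (Filter.Eventually.of_forall fun x => ?_)
    simp only [hsub]; ring
  have tL : ∫ x in Set.Iic (-m), H x ∂μ ≤ 2 * (4 * m ^ 2 + B) *
      (Real.exp (-c) * ∫ x, D (deriv φ x) * Real.exp (φ x) ∂μ) := by
    refine (h.left_tail_entPot hβ0 hβ1 hσ hm hD hDn hB habs hφ hc hLd hMm iH iD').trans ?_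
    gcongr
    rw [← integral_const_mul]
    refine (setIntegral_le_integral iD' (Filter.Eventually.of_forall fun x =>
      mul_nonneg (hD0 _) (Real.exp_pos _).le)).trans (le_of_eq ?_)
    refine integral_congr_ae (Filter.Eventually.of_forall fun x => ?_)
    simp only [hsub]; ring
  -- The four terms serve, in order, the set `φ < c` (tangent at `M`), the middle `|x| < m` (tangent
  -- at `x`), and the two tails.
  have pt : ∀ x, entPot (φ x - c) ≤ deriv φ M ^ 2 * (x ^ 2 + R ^ 2) +
      4 * m ^ 2 * (Real.exp (-c) * (D (deriv φ x) * Real.exp (φ x))) +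
      (Set.Ici m).indicator H x + (Set.Iic (-m)).indicator H x := by
    intro x
    have p1 : 0 ≤ deriv φ M ^ 2 * (x ^ 2 + R ^ 2) := by positivity
    have p2 : 0 ≤ 4 * m ^ 2 * (Real.exp (-c) * (D (deriv φ x) * Real.exp (φ x))) := by
      have := hD0 (deriv φ x); positivity
    have p3 : 0 ≤ (Set.Ici m).indicator H x := Set.indicator_nonneg (fun x _ => hH0 x) x
    have p4 : 0 ≤ (Set.Iic (-m)).indicator H x := Set.indicator_nonneg (fun x _ => hH0 x) x
    rcases lt_or_ge (φ x) c with h1 | h1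
    · have e1 := entPot_le_sq_of_nonpos (u := φ x - c) (by linarith)
      have e2 : (φ x - c) ^ 2 ≤ (deriv φ M * (x - M)) ^ 2 := by
        nlinarith [htan M x]
      have e3 : (x - M) ^ 2 ≤ 2 * (x ^ 2 + R ^ 2) := by
        have : M ^ 2 ≤ R ^ 2 := by rw [← sq_abs M]; gcongr
        nlinarith [sq_nonneg (x + M)]
      have e4 : deriv φ M ^ 2 * (x - M) ^ 2 ≤ deriv φ M ^ 2 * (2 * (x ^ 2 + R ^ 2)) :=
        mul_le_mul_of_nonneg_left e3 (sq_nonneg _)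
      nlinarith
    · have hHx : H x = entPot (φ x - c) := by simp only [hH, max_eq_left (sub_nonneg.2 h1)]
      rcases le_or_gt m x with h2 | h2
      · rw [Set.indicator_of_mem (show x ∈ Set.Ici m from h2), hHx]
        linarith
      rcases le_or_gt x (-m) with h3 | h3
      · rw [Set.indicator_of_mem (show x ∈ Set.Iic (-m) from h3), hHx]
        linarith
      have e1 := entPot_le (u := φ x - c) (by linarith)
      have e2 : (φ x - c) ^ 2 ≤ (deriv φ x * (x - M)) ^ 2 := by
        have := hup x
        have : 0 ≤ φ x - c := by linarith
        gcongr
      have e3 : (x - M) ^ 2 ≤ 4 * m ^ 2 := by nlinarith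
      have e4 : (deriv φ x * (x - M)) ^ 2 ≤ D (deriv φ x) * (4 * m ^ 2) := by
        rw [mul_pow]
        exact mul_le_mul (hD _) e3 (sq_nonneg _) (hD0 _)
      have e5 : (φ x - c) ^ 2 * Real.exp (φ x - c) ≤
          D (deriv φ x) * (4 * m ^ 2) * Real.exp (φ x - c) :=
        mul_le_mul_of_nonneg_right (e2.trans e4) (Real.exp_pos _).le
      rw [hsub x] at e1 e5
      have e6 : D (deriv φ x) * (4 * m ^ 2) * (Real.exp (-c) * Real.exp (φ x)) =
        4 * m ^ 2 * (Real.exp (-c) * (D (deriv φ x) * Real.exp (φ x))) := by ring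
      linarith
  have j1 : Integrable (fun x => deriv φ M ^ 2 * (x ^ 2 + R ^ 2)) μ :=
    (hx2.add (integrable_const _)).const_mul _
  have j2 : Integrable (fun x => 4 * m ^ 2 * (Real.exp (-c) *
      (D (deriv φ x) * Real.exp (φ x)))) μ := (iD.const_mul _).const_mul _
  have j3 : Integrable ((Set.Ici m).indicator H) μ := iH.indicator measurableSet_Ici
  have j4 : Integrable ((Set.Iic (-m)).indicator H) μ := iH.indicator measurableSet_Iic
  have hint := integral_mono iH0 (((j1.add j2).add j3).add j4) pt
  rw [integral_add' ((j1.add j2).add j3) j4, integral_add' (j1.add j2) j3, integral_add' j1 j2,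
    integral_indicator measurableSet_Ici, integral_indicator measurableSet_Iic,
    integral_const_mul, integral_const_mul, integral_const_mul,
    integral_add hx2 (integrable_const _)] at hint
  simp only [integral_const, probReal_univ, one_smul] at hint
  have hent := entropy_exp_le imul iexp c
  rw [integral_const_mul] at hent
  have hsqD : ∫ x, deriv φ x ^ 2 * Real.exp (φ x) ∂μ ≤ ∫ x, D (deriv φ x) * Real.exp (φ x) ∂μ :=
    integral_mono isq iD fun x => mul_le_mul_of_nonneg_right (hD _) (Real.exp_pos _).le
  set I := ∫ x, D (deriv φ x) * Real.exp (φ x) ∂μ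
  refine hent.trans ((mul_le_mul_of_nonneg_left hint (Real.exp_pos c).le).trans ?_)
  -- The choice of `M` converts `e^c φ'(M)²` into an integral of the cost.
  have f1 : Real.exp c * (deriv φ M ^ 2 * (∫ x, x ^ 2 ∂μ + R ^ 2)) ≤ 2 * I * (V + R ^ 2) := by
    rw [← mul_assoc]
    have hV0 : 0 ≤ ∫ x, x ^ 2 ∂μ := integral_nonneg fun x => sq_nonneg x
    exact mul_le_mul (hMle.trans (by linarith)) (by linarith) (by positivity)
      (le_trans (by positivity) (hMle.trans (mul_le_mul_of_nonneg_left hsqD zero_le_two)))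
  have f2 : Real.exp c * (Real.exp (-c) * I) = I := by rw [← mul_assoc, hec, one_mul]
  have f3 := mul_le_mul_of_nonneg_left tR (Real.exp_pos c).le
  have f4 := mul_le_mul_of_nonneg_left tL (Real.exp_pos c).le
  have f5 : Real.exp c * (2 * (4 * m ^ 2 + B) * (Real.exp (-c) * I)) =
      2 * (4 * m ^ 2 + B) * I := by linear_combination 2 * (4 * m ^ 2 + B) * f2
  have f6 : Real.exp c * (4 * m ^ 2 * (Real.exp (-c) * I)) = 4 * m ^ 2 * I := by
    linear_combination 4 * m ^ 2 * f2
  rw [f5] at f3 f4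
  rw [mul_add, mul_add, mul_add, f6]
  linarith

/-! ### Subadditivity of entropy and tensorization. -/

/-- The entropy of `exp f`, as a real number. -/
noncomputable def expEnt {α : Type*} [MeasurableSpace α] (μ : Measure α) (f : α → ℝ) : ℝ :=
  ∫ x, f x * Real.exp (f x) ∂μ - (∫ x, Real.exp (f x) ∂μ) * Real.log (∫ x, Real.exp (f x) ∂μ)

theorem exp_le_of_abs_le {f w : ℝ} (h : |f| ≤ w) : Real.exp f ≤ Real.exp (2 * w) :=
  Real.exp_le_exp.2 (by linarith [le_abs_self f, abs_nonneg f])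

theorem mul_exp_le_of_le {f w v : ℝ} (h : |f| ≤ w) (hv : v ≤ w) :
    v * Real.exp f ≤ Real.exp (2 * w) := by
  have h1 : Real.exp f ≤ Real.exp w := Real.exp_le_exp.2 ((le_abs_self f).trans h)
  have h2 : v ≤ Real.exp w := by linarith [Real.add_one_le_exp w]
  calc v * Real.exp f ≤ Real.exp w * Real.exp w :=
        mul_le_mul h2 h1 (Real.exp_pos _).le (Real.exp_pos _).le
    _ = Real.exp (2 * w) := by rw [← Real.exp_add]; ring_nf

theorem integrable_exp_of_abs_le {α : Type*} [MeasurableSpace α] {μ : Measure α} {f w : α → ℝ}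
    (hf : Measurable f) (h : ∀ x, |f x| ≤ w x) (hw : Integrable (fun x => Real.exp (2 * w x)) μ) :
    Integrable (fun x => Real.exp (f x)) μ :=
  hw.mono' hf.exp.aestronglyMeasurable (Filter.Eventually.of_forall fun x => by
    rw [Real.norm_of_nonneg (Real.exp_pos _).le]; exact exp_le_of_abs_le (h x))

theorem integrable_mul_exp_of_abs_le {α : Type*} [MeasurableSpace α] {μ : Measure α}
    {f w v : α → ℝ} (hf : Measurable f) (hv : Measurable v) (h : ∀ x, |f x| ≤ w x)
    (hvw : ∀ x, |v x| ≤ w x) (hw : Integrable (fun x => Real.exp (2 * w x)) μ) :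
    Integrable (fun x => v x * Real.exp (f x)) μ :=
  hw.mono' (hv.mul hf.exp).aestronglyMeasurable (Filter.Eventually.of_forall fun x => by
    rw [norm_mul, Real.norm_of_nonneg (Real.exp_pos _).le]
    exact mul_exp_le_of_le (h x) (hvw x))

/-- Partial integration over one variable leaves a log-marginal growing no faster than the bound in
the other variable. This makes `log F · e^f` integrable in `expEnt_prod_le`. -/
theorem abs_log_integral_exp_le {α : Type*} [MeasurableSpace α] {μ : Measure α}
    [IsProbabilityMeasure μ] {f w : α → ℝ} {v : ℝ} (hf : Measurable f) (hw : Measurable w)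
    (hw0 : ∀ x, 0 ≤ w x) (h : ∀ x, |f x| ≤ w x + v)
    (hi : Integrable (fun x => Real.exp (2 * w x)) μ) :
    |Real.log (∫ x, Real.exp (f x) ∂μ)| ≤
      v + (|Real.log (∫ x, Real.exp (w x) ∂μ)| + |Real.log (∫ x, Real.exp (-w x) ∂μ)|) := by
  have i1 : Integrable (fun x => Real.exp (w x)) μ :=
    integrable_exp_of_abs_le hw (fun x => (abs_of_nonneg (hw0 x)).le) hi
  have i2 : Integrable (fun x => Real.exp (-w x)) μ :=
    integrable_exp_of_abs_le hw.neg (fun x => by rw [abs_neg, abs_of_nonneg (hw0 x)]) hi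
  have i3 : Integrable (fun x => Real.exp (f x)) μ := by
    refine (i1.mul_const (Real.exp v)).mono' hf.exp.aestronglyMeasurable
      (Filter.Eventually.of_forall fun x => ?_)
    rw [Real.norm_of_nonneg (Real.exp_pos _).le, ← Real.exp_add]
    exact Real.exp_le_exp.2 ((le_abs_self _).trans (h x))
  have p1 := integral_exp_pos i1
  have p2 := integral_exp_pos i2
  have p3 := integral_exp_pos i3
  have u1 : ∫ x, Real.exp (f x) ∂μ ≤ Real.exp v * ∫ x, Real.exp (w x) ∂μ := by
    rw [← integral_const_mul]
    refine integral_mono i3 (i1.const_mul _) fun x => ?_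
    simp only
    rw [← Real.exp_add]
    exact Real.exp_le_exp.2 (by linarith [le_abs_self (f x), h x])
  have u2 : Real.exp (-v) * ∫ x, Real.exp (-w x) ∂μ ≤ ∫ x, Real.exp (f x) ∂μ := by
    rw [← integral_const_mul]
    refine integral_mono (i2.const_mul _) i3 fun x => ?_
    simp only
    rw [← Real.exp_add]
    exact Real.exp_le_exp.2 (by linarith [neg_abs_le (f x), h x])
  have l1 := Real.log_le_log p3 u1
  have l2 := Real.log_le_log (by positivity) u2
  rw [Real.log_mul (Real.exp_ne_zero _) p1.ne', Real.log_exp] at l1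
  rw [Real.log_mul (Real.exp_ne_zero _) p2.ne', Real.log_exp] at l2
  have a1 := abs_nonneg (Real.log (∫ x, Real.exp (w x) ∂μ))
  have a2 := abs_nonneg (Real.log (∫ x, Real.exp (-w x) ∂μ))
  rw [abs_le]
  constructor
  · linarith [neg_abs_le (Real.log (∫ x, Real.exp (-w x) ∂μ))]
  · linarith [le_abs_self (Real.log (∫ x, Real.exp (w x) ∂μ))]

/-- Subadditivity of entropy on a product of two probability spaces. -/
theorem expEnt_prod_le {α γ : Type*} [MeasurableSpace α] [MeasurableSpace γ] {μ : Measure α}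
    {ν : Measure γ} [IsProbabilityMeasure μ] [IsProbabilityMeasure ν] {f : α × γ → ℝ}
    {w : α → ℝ} {v : γ → ℝ} (hf : Measurable f) (hw : Measurable w) (hv : Measurable v)
    (hw0 : ∀ x, 0 ≤ w x) (hv0 : ∀ y, 0 ≤ v y) (h : ∀ x y, |f (x, y)| ≤ w x + v y)
    (hiw : Integrable (fun x => Real.exp (2 * w x)) μ)
    (hiv : Integrable (fun y => Real.exp (2 * v y)) ν) :
    Integrable (fun y => expEnt μ fun x => f (x, y)) ν ∧
    Integrable (fun x => expEnt ν fun y => f (x, y)) μ ∧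
    expEnt (μ.prod ν) f ≤ ∫ y, expEnt μ (fun x => f (x, y)) ∂ν +
      ∫ x, expEnt ν (fun y => f (x, y)) ∂μ := by
  set F : γ → ℝ := fun y => ∫ x, Real.exp (f (x, y)) ∂μ with hF
  set G : α → ℝ := fun x => ∫ y, Real.exp (f (x, y)) ∂ν with hG
  have hmx : ∀ y, Measurable fun x => f (x, y) := fun y => hf.comp measurable_prodMk_right
  have hmy : ∀ x, Measurable fun y => f (x, y) := fun x => hf.comp measurable_prodMk_left
  have hFm : Measurable F :=
    (StronglyMeasurable.integral_prod_left' hf.exp.stronglyMeasurable).measurable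
  have hGm : Measurable G :=
    (StronglyMeasurable.integral_prod_right' hf.exp.stronglyMeasurable).measurable
  have hdom : Integrable (fun p : α × γ => Real.exp (2 * (w p.1 + v p.2))) (μ.prod ν) := by
    refine (hiw.mul_prod hiv).congr (Filter.Eventually.of_forall fun p => ?_)
    simp only
    rw [← Real.exp_add]; ring_nf
  have hb : ∀ p : α × γ, |f p| ≤ w p.1 + v p.2 := fun p => h p.1 p.2
  have iE : Integrable (fun p => Real.exp (f p)) (μ.prod ν) := integrable_exp_of_abs_le hf hb hdom
  have iT : Integrable (fun p => f p * Real.exp (f p)) (μ.prod ν) :=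
    integrable_mul_exp_of_abs_le hf hf hb hb hdom
  have hFb : ∃ κ, ∀ y, |Real.log (F y)| ≤ v y + κ := ⟨_, fun y =>
    abs_log_integral_exp_le (hmx y) hw hw0 (fun x => h x y) hiw⟩
  have hGb : ∃ κ, ∀ x, |Real.log (G x)| ≤ w x + κ := ⟨_, fun x =>
    abs_log_integral_exp_le (hmy x) hv hv0 (fun y => (h x y).trans (add_comm _ _).le) hiv⟩
  obtain ⟨κ, hκ⟩ := hFb
  obtain ⟨κ', hκ'⟩ := hGb
  have iV : Integrable (fun p => (v p.2 + κ) * Real.exp (f p)) (μ.prod ν) := by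
    have := (integrable_mul_exp_of_abs_le (v := fun p : α × γ => v p.2) hf
      (hv.comp measurable_snd) hb (fun p => by
        rw [abs_of_nonneg (hv0 _)]; linarith [hw0 p.1]) hdom).add (iE.const_mul κ)
    refine this.congr (Filter.Eventually.of_forall fun p => ?_)
    simp only [Pi.add_apply]; ring
  have iW : Integrable (fun p => (w p.1 + κ') * Real.exp (f p)) (μ.prod ν) := by
    have := (integrable_mul_exp_of_abs_le (v := fun p : α × γ => w p.1) hf
      (hw.comp measurable_fst) hb (fun p => by
        rw [abs_of_nonneg (hw0 _)]; linarith [hv0 p.2]) hdom).add (iE.const_mul κ')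
    refine this.congr (Filter.Eventually.of_forall fun p => ?_)
    simp only [Pi.add_apply]; ring
  have iF : Integrable (fun p => Real.log (F p.2) * Real.exp (f p)) (μ.prod ν) := by
    refine iV.mono' ((hFm.log.comp measurable_snd).mul hf.exp).aestronglyMeasurable
      (Filter.Eventually.of_forall fun p => ?_)
    rw [norm_mul, Real.norm_of_nonneg (Real.exp_pos _).le]
    exact mul_le_mul_of_nonneg_right (hκ _) (Real.exp_pos _).le
  have iG : Integrable (fun p => Real.log (G p.1) * Real.exp (f p)) (μ.prod ν) := by
    refine iW.mono' ((hGm.log.comp measurable_fst).mul hf.exp).aestronglyMeasurable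
      (Filter.Eventually.of_forall fun p => ?_)
    rw [norm_mul, Real.norm_of_nonneg (Real.exp_pos _).le]
    exact mul_le_mul_of_nonneg_right (hκ' _) (Real.exp_pos _).le
  have iF1 : Integrable (fun y => F y * Real.log (F y)) ν := by
    refine iF.integral_prod_right.congr (Filter.Eventually.of_forall fun y => ?_)
    simp only [hF]
    rw [integral_const_mul, mul_comm]
  have iG1 : Integrable (fun x => G x * Real.log (G x)) μ := by
    refine iG.integral_prod_left.congr (Filter.Eventually.of_forall fun x => ?_)
    simp only [hG]
    rw [integral_const_mul, mul_comm]
  have eF : ∫ p, Real.log (F p.2) * Real.exp (f p) ∂(μ.prod ν) = ∫ y, F y * Real.log (F y) ∂ν := by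
    rw [integral_prod_symm _ iF]
    refine integral_congr_ae (Filter.Eventually.of_forall fun y => ?_)
    simp only [hF]
    rw [integral_const_mul, mul_comm]
  have eG : ∫ p, Real.log (G p.1) * Real.exp (f p) ∂(μ.prod ν) = ∫ x, G x * Real.log (G x) ∂μ := by
    rw [integral_prod _ iG]
    refine integral_congr_ae (Filter.Eventually.of_forall fun x => ?_)
    simp only [hG]
    rw [integral_const_mul, mul_comm]
  have iFE : Integrable F ν := iE.integral_prod_right
  have iGE : Integrable G μ := iE.integral_prod_left
  set E := ∫ p, Real.exp (f p) ∂(μ.prod ν) with hE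
  have eFE : ∫ y, F y ∂ν = E := (integral_prod_symm _ iE).symm
  have eGE : ∫ x, G x ∂μ = E := (integral_prod _ iE).symm
  have hEpos : 0 < E := integral_exp_pos iE
  refine ⟨iT.integral_prod_right.sub iF1, iT.integral_prod_left.sub iG1, ?_⟩
  have r1 : ∫ y, expEnt μ (fun x => f (x, y)) ∂ν =
      ∫ p, f p * Real.exp (f p) ∂(μ.prod ν) - ∫ y, F y * Real.log (F y) ∂ν := by
    rw [integral_prod_symm _ iT, ← integral_sub iT.integral_prod_right iF1]
    rfl
  have r2 : ∫ x, expEnt ν (fun y => f (x, y)) ∂μ =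
      ∫ p, f p * Real.exp (f p) ∂(μ.prod ν) - ∫ x, G x * Real.log (G x) ∂μ := by
    rw [integral_prod _ iT, ← integral_sub iT.integral_prod_left iG1]
    rfl
  have hexpx : ∀ y, Integrable (fun x => Real.exp (f (x, y))) μ := fun y => by
    refine integrable_exp_of_abs_le (hmx y) (fun x => h x y) ?_
    refine (hiw.mul_const (Real.exp (2 * v y))).congr (Filter.Eventually.of_forall fun x => ?_)
    simp only
    rw [← Real.exp_add]; ring_nf
  have hexpy : ∀ x, Integrable (fun y => Real.exp (f (x, y))) ν := fun x => by
    refine integrable_exp_of_abs_le (hmy x) (fun y => h x y) ?_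
    refine (hiv.mul_const (Real.exp (2 * w x))).congr (Filter.Eventually.of_forall fun y => ?_)
    simp only
    rw [← Real.exp_add]; ring_nf
  -- This is `1 + z ≤ e^z` at `z = log F + log G - log E - f`, multiplied by `e^f`. On integration
  -- the last term becomes `E`, because `F` and `G` both have integral `E`, and cancels the `-E`.
  have pt : ∀ p : α × γ, Real.log (F p.2) * Real.exp (f p) + Real.log (G p.1) * Real.exp (f p) ≤
      f p * Real.exp (f p) + (Real.log E - 1) * Real.exp (f p) + E⁻¹ * (G p.1 * F p.2) := by
    intro p
    have pF : 0 < F p.2 := integral_exp_pos (hexpx _)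
    have pG : 0 < G p.1 := integral_exp_pos (hexpy _)
    have h1 := Real.add_one_le_exp (Real.log (F p.2) + Real.log (G p.1) - Real.log E - f p)
    rw [Real.exp_sub, Real.exp_sub, Real.exp_add, Real.exp_log pF, Real.exp_log pG,
      Real.exp_log hEpos, le_div_iff₀ (Real.exp_pos _)] at h1
    have h2 : E⁻¹ * (G p.1 * F p.2) = F p.2 * G p.1 / E := by
      rw [div_eq_inv_mul, mul_comm (G p.1)]
    rw [h2]
    linarith
  have iR : Integrable (fun p : α × γ => E⁻¹ * (G p.1 * F p.2)) (μ.prod ν) :=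
    (iGE.mul_prod iFE).const_mul _
  have hint := integral_mono (iF.add iG) ((iT.add (iE.const_mul (Real.log E - 1))).add iR) pt
  rw [integral_add' iF iG, integral_add' (iT.add (iE.const_mul _)) iR,
    integral_add' iT (iE.const_mul _), integral_const_mul, integral_const_mul, integral_prod_mul,
    eF, eG, eFE, eGE, ← hE, inv_mul_cancel_left₀ hEpos.ne'] at hint
  rw [r1, r2, expEnt, ← hE]
  linarith

theorem integrable_exp_sum_abs {n : ℕ} {μ : Fin n → Measure ℝ} [∀ i, IsProbabilityMeasure (μ i)]
    {L : ℝ} (h : ∀ i, Integrable (fun x => Real.exp (2 * L * |x|)) (μ i)) :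
    Integrable (fun x : Fin n → ℝ => Real.exp (2 * (L * ∑ i, |x i|))) (Measure.pi μ) := by
  refine (Integrable.fintype_prod (f := fun _ x => Real.exp (2 * L * |x|)) h).congr
    (Filter.Eventually.of_forall fun x => ?_)
  simp only
  rw [← Real.exp_sum, ← mul_assoc, Finset.mul_sum]

theorem hasDerivAt_cons {n : ℕ} (x : ℝ) (y : Fin n → ℝ) :
    HasDerivAt (fun x : ℝ => (Fin.cons x y : Fin (n + 1) → ℝ)) (Pi.single 0 1) x := by
  refine hasDerivAt_pi.2 fun i => ?_
  refine Fin.cases ?_ (fun i => ?_) i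
  · simpa using hasDerivAt_id' x
  · simpa using hasDerivAt_const x (y i)

theorem deriv_comp_cons {n : ℕ} {φ : (Fin (n + 1) → ℝ) → ℝ} (hφ : Differentiable ℝ φ) (x : ℝ)
    (y : Fin n → ℝ) : deriv (fun x => φ (Fin.cons x y)) x = grad φ (Fin.cons x y) 0 :=
  ((hφ _).hasFDerivAt.comp_hasDerivAt x (hasDerivAt_cons x y)).deriv

theorem grad_comp_cons {n : ℕ} {φ : (Fin (n + 1) → ℝ) → ℝ} (hφ : Differentiable ℝ φ) (x : ℝ)
    (y : Fin n → ℝ) (i : Fin n) :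
    grad (fun y => φ (Fin.cons x y)) y i = grad φ (Fin.cons x y) i.succ := by
  set A : (Fin n → ℝ) →L[ℝ] (Fin (n + 1) → ℝ) :=
    ContinuousLinearMap.pi (Fin.cons 0 fun i => ContinuousLinearMap.proj i) with hA
  have h1 : HasFDerivAt (fun y : Fin n → ℝ => (Fin.cons x y : Fin (n + 1) → ℝ)) A y := by
    refine hasFDerivAt_pi'.2 fun j => ?_
    refine Fin.cases ?_ (fun j => ?_) j
    · simpa [hA] using hasFDerivAt_const x y
    · simpa [hA] using hasFDerivAt_apply (𝕜 := ℝ) j y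
  have h2 := ((hφ _).hasFDerivAt.comp y h1).fderiv
  unfold grad
  simp only [Function.comp_def] at h2
  rw [h2, ContinuousLinearMap.comp_apply]
  congr 1
  ext j
  refine Fin.cases ?_ (fun j => ?_) j
  · simp [hA]
  · simp [hA, Pi.single_apply]

theorem contDiff_cons_left {n : ℕ} (y : Fin n → ℝ) :
    ContDiff ℝ 1 fun x : ℝ => (Fin.cons x y : Fin (n + 1) → ℝ) := by
  refine contDiff_pi.2 fun i => ?_
  refine Fin.cases ?_ (fun i => ?_) i
  · simpa using contDiff_fun_id
  · simpa using contDiff_const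

theorem contDiff_cons_right {n : ℕ} (x : ℝ) :
    ContDiff ℝ 1 fun y : Fin n → ℝ => (Fin.cons x y : Fin (n + 1) → ℝ) := by
  refine contDiff_pi.2 fun i => ?_
  refine Fin.cases ?_ (fun i => ?_) i
  · simpa using contDiff_const
  · simpa using contDiff_apply ℝ ℝ i

theorem continuous_cons {n : ℕ} :
    Continuous fun p : ℝ × (Fin n → ℝ) => (Fin.cons p.1 p.2 : Fin (n + 1) → ℝ) := by
  refine continuous_pi fun i => ?_
  refine Fin.cases ?_ (fun i => ?_) i
  · simpa using continuous_fst
  · simp only [Fin.cons_succ]; fun_prop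

theorem convexOn_comp_cons_left {n : ℕ} {φ : (Fin (n + 1) → ℝ) → ℝ}
    (hφ : ConvexOn ℝ Set.univ φ) (y : Fin n → ℝ) :
    ConvexOn ℝ Set.univ fun x : ℝ => φ (Fin.cons x y) := by
  refine ⟨convex_univ, fun a _ b _ s t hs ht hst => ?_⟩
  refine le_trans (le_of_eq ?_) (hφ.2 (Set.mem_univ (Fin.cons a y)) (Set.mem_univ (Fin.cons b y))
    hs ht hst)
  refine congrArg φ (funext fun j => ?_)
  refine Fin.cases ?_ (fun j => ?_) j
  · simp
  · simp [← add_mul, hst]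

theorem convexOn_comp_cons_right {n : ℕ} {φ : (Fin (n + 1) → ℝ) → ℝ}
    (hφ : ConvexOn ℝ Set.univ φ) (x : ℝ) :
    ConvexOn ℝ Set.univ fun y : Fin n → ℝ => φ (Fin.cons x y) := by
  refine ⟨convex_univ, fun a _ b _ s t hs ht hst => ?_⟩
  refine le_trans (le_of_eq ?_) (hφ.2 (Set.mem_univ (Fin.cons x a)) (Set.mem_univ (Fin.cons x b))
    hs ht hst)
  refine congrArg φ (funext fun j => ?_)
  refine Fin.cases ?_ (fun j => ?_) j
  · simp [← add_mul, hst]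
  · simp

theorem continuous_grad {n : ℕ} {φ : (Fin n → ℝ) → ℝ} (hφ : ContDiff ℝ 1 φ) (i : Fin n) :
    Continuous fun x => grad φ x i :=
  (hφ.continuous_fderiv (by norm_num)).clm_apply continuous_const

theorem abs_grad_le {n : ℕ} {φ : (Fin n → ℝ) → ℝ} (hφ : Differentiable ℝ φ) {L : ℝ} (hL : 0 ≤ L)
    (h : ∀ x y, |φ x - φ y| ≤ L * ∑ i, |x i - y i|) (x : Fin n → ℝ) (i : Fin n) :
    |grad φ x i| ≤ L := by
  have hd : HasDerivAt (fun t : ℝ => φ (x + t • Pi.single i 1)) (grad φ x i) 0 := by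
    have h1 : HasDerivAt (fun t : ℝ => x + t • (Pi.single i 1 : Fin n → ℝ)) (Pi.single i 1) 0 := by
      simpa using ((hasDerivAt_id (0 : ℝ)).smul_const (Pi.single i (1 : ℝ))).const_add x
    have h2 : HasFDerivAt φ (fderiv ℝ φ x) (x + (0 : ℝ) • Pi.single i 1) := by
      simpa using (hφ x).hasFDerivAt
    exact h2.comp_hasDerivAt 0 h1
  rw [← hd.deriv]
  refine abs_deriv_le_of_lipschitz hL (fun s t => ?_) 0
  refine (h _ _).trans (le_of_eq ?_)
  congr 1
  rw [Finset.sum_eq_single i]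
  · simp
  · intro j _ hj
    simp [hj]
  · simp

/-- Tensorization of a modified log-Sobolev inequality for convex functions. -/
theorem expEnt_pi_le {D : ℝ → ℝ} {L C : ℝ} (hDc : Continuous D) (hL : 0 < L) {n : ℕ}
    {μ : Fin n → Measure ℝ} (hμ : ∀ i, IsProbabilityMeasure (μ i))
    (hexp : ∀ i, Integrable (fun x => Real.exp (2 * L * |x|)) (μ i))
    (hline : ∀ i, ∀ φ : ℝ → ℝ, ContDiff ℝ 1 φ → ConvexOn ℝ Set.univ φ →
      (∀ x y, |φ x - φ y| ≤ L * |x - y|) →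
      expEnt (μ i) φ ≤ C * ∫ x, D (deriv φ x) * Real.exp (φ x) ∂(μ i))
    {φ : (Fin n → ℝ) → ℝ} (hφ : ContDiff ℝ 1 φ) (hc : ConvexOn ℝ Set.univ φ)
    (hlip : ∀ x y, |φ x - φ y| ≤ L * ∑ i, |x i - y i|) :
    expEnt (Measure.pi μ) φ ≤
      C * ∫ x, (∑ i, D (grad φ x i)) * Real.exp (φ x) ∂(Measure.pi μ) := by
  induction n with
  | zero =>
    have hconst : φ = fun _ => φ 0 := funext fun x => by rw [Subsingleton.elim x 0]
    rw [hconst]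
    simp [expEnt, mul_comm]
  | succ n ih =>
    set ν : Fin n → Measure ℝ := fun j => μ j.succ with hν
    have hdiff : Differentiable ℝ φ := hφ.differentiable (by norm_num)
    have mp := (measurePreserving_piFinSuccAbove μ 0).symm
    have hpi : ∀ F : (Fin (n + 1) → ℝ) → ℝ, ∫ x, F x ∂(Measure.pi μ) =
        ∫ p, F (Fin.cons p.1 p.2) ∂((μ 0).prod (Measure.pi ν)) := by
      intro F
      rw [← mp.integral_comp']
      simp only [MeasurableEquiv.piFinSuccAbove_symm_apply, Fin.insertNthEquiv_zero]
      rfl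
    obtain ⟨K, hK⟩ : ∃ K, ∀ d ∈ Set.Icc (-L) L, ‖D d‖ ≤ K :=
      isCompact_Icc.exists_bound_of_continuousOn hDc.continuousOn
    have hgb := abs_grad_le hdiff hL.le hlip
    set f : ℝ × (Fin n → ℝ) → ℝ := fun p => φ (Fin.cons p.1 p.2) with hf
    have hfc : Continuous f := hφ.continuous.comp continuous_cons
    set w : ℝ → ℝ := fun x => |φ 0| + L * |x| with hw
    set v : (Fin n → ℝ) → ℝ := fun y => L * ∑ i, |y i| with hv
    have hbound : ∀ x y, |f (x, y)| ≤ w x + v y := by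
      intro x y
      have h1 := hlip (Fin.cons x y) 0
      rw [Fin.sum_univ_succ] at h1
      simp only [Fin.cons_zero, Fin.cons_succ, Pi.zero_apply, sub_zero] at h1
      have h2 := abs_sub_abs_le_abs_sub (φ (Fin.cons x y)) (φ 0)
      simp only [hf, hw, hv]
      linarith
    have hiw : Integrable (fun x => Real.exp (2 * w x)) (μ 0) := by
      refine ((hexp 0).const_mul (Real.exp (2 * |φ 0|))).congr
        (Filter.Eventually.of_forall fun x => ?_)
      simp only [hw]
      rw [← Real.exp_add]; ring_nf
    have hiv : Integrable (fun y => Real.exp (2 * v y)) (Measure.pi ν) :=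
      integrable_exp_sum_abs fun j => hexp j.succ
    have hw0 : ∀ x, 0 ≤ w x := fun x => by positivity
    have hv0 : ∀ y, 0 ≤ v y := fun y =>
      mul_nonneg hL.le (Finset.sum_nonneg fun i _ => abs_nonneg _)
    have hdom : Integrable (fun p : ℝ × (Fin n → ℝ) => Real.exp (2 * (w p.1 + v p.2)))
        ((μ 0).prod (Measure.pi ν)) := by
      refine (hiw.mul_prod hiv).congr (Filter.Eventually.of_forall fun p => ?_)
      simp only
      rw [← Real.exp_add]; ring_nf
    have iE : Integrable (fun p => Real.exp (f p)) ((μ 0).prod (Measure.pi ν)) :=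
      integrable_exp_of_abs_le hfc.measurable (fun p => hbound p.1 p.2) hdom
    have iD : ∀ i, Integrable (fun p : ℝ × (Fin n → ℝ) =>
        D (grad φ (Fin.cons p.1 p.2) i) * Real.exp (f p)) ((μ 0).prod (Measure.pi ν)) := by
      intro i
      refine (iE.const_mul K).mono' (((hDc.comp ((continuous_grad hφ i).comp
        continuous_cons)).mul hfc.rexp).aestronglyMeasurable)
        (Filter.Eventually.of_forall fun p => ?_)
      rw [norm_mul, Real.norm_of_nonneg (Real.exp_pos _).le]
      exact mul_le_mul_of_nonneg_right (hK _ (abs_le.1 (hgb _ i))) (Real.exp_pos _).le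
    obtain ⟨i1, i2, hle⟩ := expEnt_prod_le hfc.measurable (by fun_prop) (by fun_prop) hw0 hv0
      hbound hiw hiv
    have hent : expEnt (Measure.pi μ) φ = expEnt ((μ 0).prod (Measure.pi ν)) f := by
      unfold expEnt
      rw [hpi, hpi]
    have iS : Integrable (fun p : ℝ × (Fin n → ℝ) =>
        (∑ i : Fin n, D (grad φ (Fin.cons p.1 p.2) i.succ)) * Real.exp (f p))
        ((μ 0).prod (Measure.pi ν)) := by
      simp_rw [Finset.sum_mul]
      exact integrable_finsetSum _ fun i _ => iD i.succ
    -- The line inequality in the first coordinate, integrated over the others; `e2` is the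
    -- induction hypothesis in the remaining coordinates.
    have e1 : ∫ y, expEnt (μ 0) (fun x => f (x, y)) ∂(Measure.pi ν) ≤
        C * ∫ p : ℝ × (Fin n → ℝ), D (grad φ (Fin.cons p.1 p.2) 0) * Real.exp (f p)
          ∂((μ 0).prod (Measure.pi ν)) := by
      rw [integral_prod_symm _ (iD 0), ← integral_const_mul]
      refine integral_mono i1 ((iD 0).integral_prod_right.const_mul C) fun y => ?_
      have := hline 0 (fun x => f (x, y)) (hφ.comp (contDiff_cons_left y))
        (convexOn_comp_cons_left hc y) (fun a b => by
          refine (hlip _ _).trans (le_of_eq ?_)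
          rw [Fin.sum_univ_succ]
          simp)
      simpa only [hf, deriv_comp_cons hdiff] using this
    have e2 : ∫ x, expEnt (Measure.pi ν) (fun y => f (x, y)) ∂(μ 0) ≤
        C * ∫ p : ℝ × (Fin n → ℝ), (∑ i : Fin n, D (grad φ (Fin.cons p.1 p.2) i.succ)) *
          Real.exp (f p) ∂((μ 0).prod (Measure.pi ν)) := by
      rw [integral_prod _ iS, ← integral_const_mul]
      refine integral_mono i2 (iS.integral_prod_left.const_mul C) fun x => ?_
      have := ih (μ := ν) (fun j => hμ j.succ) (fun j => hexp j.succ) (fun j => hline j.succ)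
        (φ := fun y => f (x, y)) (hφ.comp (contDiff_cons_right x))
        (convexOn_comp_cons_right hc x) (fun a b => by
          refine (hlip _ _).trans (le_of_eq ?_)
          rw [Fin.sum_univ_succ]
          simp)
      simpa only [hf, grad_comp_cons hdiff] using this
    rw [hent, hpi]
    refine hle.trans ((add_le_add e1 e2).trans (le_of_eq ?_))
    rw [← mul_add, ← integral_add (iD 0) iS]
    congr 1
    refine integral_congr_ae (Filter.Eventually.of_forall fun p => ?_)
    simp only [hf]
    rw [Fin.sum_univ_succ, add_mul]

/-! ### Absorption of the tail term and the uniform constant on the line. -/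

/-- Weighted Young inequality with a prescribed small `ε`. Either `A y^θ ≤ ε x^θ` and the first term
suffices, or `x` is at most a constant times `y`. -/
theorem exists_rpow_mul_rpow_le {A ε θ : ℝ} (hA : 0 ≤ A) (hε : 0 < ε) (hθ0 : 0 < θ)
    (hθ1 : θ ≤ 1) :
    ∃ B, 0 ≤ B ∧ ∀ x y : ℝ, 0 ≤ x → 0 ≤ y → A * (x ^ (1 - θ) * y ^ θ) ≤ ε * x + B * y := by
  refine ⟨A * ((A / ε) ^ (1 / θ)) ^ (1 - θ), by positivity, fun x y hx hy => ?_⟩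
  have hx1 : x ^ (1 - θ) * x ^ θ = x := by
    rw [← Real.rpow_add_of_nonneg hx (by linarith) hθ0.le]; simp
  have hy1 : y ^ (1 - θ) * y ^ θ = y := by
    rw [← Real.rpow_add_of_nonneg hy (by linarith) hθ0.le]; simp
  have hx2 : 0 ≤ x ^ (1 - θ) := by positivity
  rcases le_or_gt (A * y ^ θ) (ε * x ^ θ) with h | h
  · have h1 : x ^ (1 - θ) * (A * y ^ θ) ≤ x ^ (1 - θ) * (ε * x ^ θ) :=
      mul_le_mul_of_nonneg_left h hx2
    have h2 : x ^ (1 - θ) * (ε * x ^ θ) = ε * x := by rw [mul_left_comm, hx1]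
    have h3 : 0 ≤ A * ((A / ε) ^ (1 / θ)) ^ (1 - θ) * y := by positivity
    linarith
  · have h1 : x ^ θ ≤ ((A / ε) ^ (1 / θ) * y) ^ θ := by
      rw [Real.mul_rpow (by positivity) hy, ← Real.rpow_mul (by positivity),
        one_div_mul_cancel hθ0.ne', Real.rpow_one, div_mul_eq_mul_div, le_div_iff₀ hε]
      linarith
    have h2 : x ≤ (A / ε) ^ (1 / θ) * y := (Real.rpow_le_rpow_iff hx (by positivity) hθ0).1 h1
    have h3 : x ^ (1 - θ) ≤ ((A / ε) ^ (1 / θ)) ^ (1 - θ) * y ^ (1 - θ) := by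
      rw [← Real.mul_rpow (by positivity) hy]
      exact Real.rpow_le_rpow hx h2 (by linarith)
    calc A * (x ^ (1 - θ) * y ^ θ)
        ≤ A * (((A / ε) ^ (1 / θ)) ^ (1 - θ) * y ^ (1 - θ) * y ^ θ) := by gcongr
      _ = A * ((A / ε) ^ (1 / θ)) ^ (1 - θ) * y := by rw [mul_assoc _ (y ^ (1 - θ)), hy1]; ring
      _ ≤ _ := by linarith [mul_nonneg hε.le hx]

/-- The one-dimensional cost in the modified log-Sobolev inequality. -/
noncomputable def modCost (β d : ℝ) : ℝ :=
  if β = 0 then d ^ 2 else max (d ^ 2) (|d| ^ ((β + 1) / β))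

theorem sq_le_modCost (β d : ℝ) : d ^ 2 ≤ modCost β d := by
  unfold modCost
  split_ifs
  · exact le_rfl
  · exact le_max_left _ _

theorem modCost_neg (β d : ℝ) : modCost β (-d) = modCost β d := by simp [modCost]

theorem continuous_modCost {β : ℝ} (hβ : 0 ≤ β) : Continuous (modCost β) := by
  unfold modCost
  split_ifs
  · fun_prop
  · exact (continuous_pow 2).max (continuous_abs.rpow_const fun x => Or.inr (by positivity))

/-- The boundary term in the tail estimate is absorbed by the entropy potential. -/
theorem exists_absorption (β σ : ℝ) (hβ0 : 0 ≤ β) (hβ1 : β ≤ 1) (hσ : 0 ≤ σ) :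
    ∃ B, 0 ≤ B ∧ ∀ L, (β = 0 → L * σ ≤ 1 / 6) → ∀ u d, 0 ≤ u → 0 ≤ d → d ≤ L →
      2 ^ β * σ ^ (β + 1) * (u ^ (1 - β) * d ^ (1 + β)) * Real.exp u ≤
        entPot u / 2 + B * modCost β d * Real.exp u := by
  rcases hβ0.eq_or_lt with rfl | hβ
  · refine ⟨3 * σ ^ 2, by positivity, fun L hL u d hu hd hdL => ?_⟩
    have h1 : σ * d ≤ 1 / 6 := by nlinarith [hL rfl]
    have hE := Real.exp_pos u
    simp only [modCost, if_true, Real.rpow_zero, zero_add, Real.rpow_one, sub_zero, add_zero,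
      one_mul]
    rcases le_total u 1 with h | h
    · have h2 : σ * (u * d) ≤ u ^ 2 / 12 + 3 * σ ^ 2 * d ^ 2 := by
        nlinarith [sq_nonneg (u - 6 * (σ * d))]
      have h3 := mul_le_mul_of_nonneg_right h2 hE.le
      linarith [sq_mul_exp_le_entPot hu h]
    · have h2 : σ * (u * d) ≤ u / 6 := by nlinarith
      have h3 := mul_le_mul_of_nonneg_right h2 hE.le
      have h4 : 0 ≤ 3 * σ ^ 2 * d ^ 2 * Real.exp u := by positivity
      linarith [mul_exp_le_entPot h]
  · set A := 2 ^ β * σ ^ (β + 1) with hA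
    have hA0 : 0 ≤ A := by positivity
    -- For `u ≤ 1` interpolate between `u²` and `d²`; for `u ≥ 1` between `u` and `d^((β+1)/β)`.
    -- These are the sizes of `e^(-u) entPot u` in the two ranges, paired with the two branches of
    -- the cost.
    obtain ⟨B1, hB1, h1⟩ := exists_rpow_mul_rpow_le (θ := (1 + β) / 2) hA0
      (by norm_num : (0 : ℝ) < 1 / 12) (by linarith) (by linarith)
    obtain ⟨B2, hB2, h2⟩ := exists_rpow_mul_rpow_le (θ := β) hA0
      (by norm_num : (0 : ℝ) < 1 / 6) hβ hβ1
    refine ⟨B1 + B2, by positivity, fun L _ u d hu hd _ => ?_⟩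
    have hE := Real.exp_pos u
    have hm1 : d ^ 2 ≤ modCost β d := sq_le_modCost β d
    have hm2 : d ^ ((β + 1) / β) ≤ modCost β d := by
      rw [modCost, if_neg hβ.ne', abs_of_nonneg hd]; exact le_max_right _ _
    have hm0 : 0 ≤ modCost β d := (sq_nonneg d).trans hm1
    rcases le_total u 1 with h | h
    · have h3 := h1 (u ^ 2) (d ^ 2) (by positivity) (by positivity)
      rw [← Real.rpow_natCast u, ← Real.rpow_natCast d, ← Real.rpow_mul hu, ← Real.rpow_mul hd,
        show ((2 : ℕ) : ℝ) * (1 - (1 + β) / 2) = 1 - β by push_cast; ring,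
        show ((2 : ℕ) : ℝ) * ((1 + β) / 2) = 1 + β by push_cast; ring,
        Real.rpow_natCast, Real.rpow_natCast] at h3
      have h4 : A * (u ^ (1 - β) * d ^ (1 + β)) ≤ 1 / 12 * u ^ 2 + (B1 + B2) * modCost β d := by
        nlinarith [mul_nonneg hB2 hm0, mul_le_mul_of_nonneg_left hm1 hB1]
      have h5 := mul_le_mul_of_nonneg_right h4 hE.le
      linarith [sq_mul_exp_le_entPot hu h]
    · have h3 := h2 u (d ^ ((β + 1) / β)) hu (by positivity)
      rw [← Real.rpow_mul hd, div_mul_cancel₀ _ hβ.ne', add_comm β 1] at h3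
      have h4 : A * (u ^ (1 - β) * d ^ (1 + β)) ≤ 1 / 6 * u + (B1 + B2) * modCost β d := by
        rw [add_comm β 1] at hm2
        nlinarith [mul_nonneg hB1 hm0, mul_le_mul_of_nonneg_left hm2 hB2]
      have h5 := mul_le_mul_of_nonneg_right h4 hE.le
      linarith [mul_exp_le_entPot h]

/-- The modified log-Sobolev inequality on the line holds uniformly over the class. -/
theorem exists_line_const (β m σ : ℝ) (hβ0 : 0 ≤ β) (hβ1 : β ≤ 1) (hm : 0 < m) (hσ : 0 ≤ σ) :
    ∃ C, 0 < C ∧ ∀ L, 0 < L → (β = 0 → L * σ ≤ 1 / 6) → ∀ μ, MemClassM β m σ μ →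
      Integrable (fun x => Real.exp (2 * L * |x|)) μ →
      ∀ φ : ℝ → ℝ, ContDiff ℝ 1 φ → ConvexOn ℝ Set.univ φ →
      (∀ x y, |φ x - φ y| ≤ L * |x - y|) →
      expEnt μ φ ≤ C * ∫ x, modCost β (deriv φ x) * Real.exp (φ x) ∂μ := by
  obtain ⟨V, hV, hVb⟩ := exists_second_moment_bound β m σ hm hσ hβ0
  obtain ⟨B, hB, habs⟩ := exists_absorption β σ hβ0 hβ1 hσ
  set R := 2 * V + 1 with hR
  -- `R = 2V + 1` gives `R² ≥ 2V`, and raising `m` to `m'` gives `R + 1 ≤ m'`. All choices depend on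
  -- `β, m, σ` only.
  set m' := m + (R + 1) with hm'
  have hR0 : 0 < R := by positivity
  have hm0 : 0 < m' := by positivity
  refine ⟨2 * (V + R ^ 2) + 4 * m' ^ 2 + 4 * (4 * m' ^ 2 + B), by positivity,
    fun L hL hLσ μ hμ hexp φ hφ hc hlip => ?_⟩
  have hμ' : MemClassM β m' σ μ := hμ.mono (by linarith)
  exact hμ'.entropy_exp_le_integral hβ0 hβ1 hσ hm0 (sq_le_modCost β) (continuous_modCost hβ0)
    (modCost_neg β) hB hR0 (by nlinarith) (by linarith) (hVb μ hμ).1 (hVb μ hμ).2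
    (habs L hLσ) hL hexp hφ hc hlip

/-! ### Gradients, `ℓ_p` norms and the existence of an admissible constant. -/

theorem fderiv_apply_eq_sum {n : ℕ} (φ : (Fin n → ℝ) → ℝ) (x v : Fin n → ℝ) :
    fderiv ℝ φ x v = ∑ i, v i * grad φ x i := by
  conv_lhs => rw [← Finset.univ_sum_single v]
  rw [map_sum]
  refine Finset.sum_congr rfl fun i _ => ?_
  have : (Pi.single i (v i) : Fin n → ℝ) = v i • Pi.single i 1 := by
    rw [← Pi.single_smul, smul_eq_mul, mul_one]
  rw [this, map_smul, smul_eq_mul, grad]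

theorem abs_sub_le_of_abs_grad_le {n : ℕ} {φ : (Fin n → ℝ) → ℝ} (hφ : Differentiable ℝ φ) {L : ℝ}
    (h : ∀ x i, |grad φ x i| ≤ L) (x y : Fin n → ℝ) :
    |φ x - φ y| ≤ L * ∑ i, |x i - y i| := by
  have hd : ∀ t : ℝ, HasDerivAt (fun t : ℝ => φ (y + t • (x - y)))
      (fderiv ℝ φ (y + t • (x - y)) (x - y)) t := by
    intro t
    have h1 : HasDerivAt (fun t : ℝ => y + t • (x - y)) (x - y) t := by
      simpa using ((hasDerivAt_id' t).smul_const (x - y)).const_add y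
    exact (hφ _).hasFDerivAt.comp_hasDerivAt t h1
  have := norm_image_sub_le_of_norm_deriv_le_segment_01' (C := L * ∑ i, |x i - y i|)
    (fun t _ => (hd t).hasDerivWithinAt) fun t _ => by
      rw [fderiv_apply_eq_sum, Finset.mul_sum]
      refine (norm_sum_le _ _).trans (Finset.sum_le_sum fun i _ => ?_)
      rw [norm_mul, mul_comm]
      exact mul_le_mul_of_nonneg_right (h _ i) (norm_nonneg _)
  simpa using this

theorem abs_sub_le_of_lipschitz {n : ℕ} {φ : (Fin n → ℝ) → ℝ} {K : NNReal}
    (h : LipschitzWith K φ) (x y : Fin n → ℝ) : |φ x - φ y| ≤ (K + 1) * ∑ i, |x i - y i| := by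
  have h1 := h.dist_le_mul x y
  rw [Real.dist_eq] at h1
  have h2 : dist x y ≤ ∑ i, |x i - y i| :=
    (dist_pi_le_iff (Finset.sum_nonneg fun i _ => abs_nonneg _)).2 fun i => by
      rw [Real.dist_eq]
      exact Finset.single_le_sum (f := fun i => |x i - y i|) (fun i _ => abs_nonneg _)
        (Finset.mem_univ i)
  have h3 : (0 : ℝ) ≤ K := K.2
  have h4 : 0 ≤ dist x y := dist_nonneg
  nlinarith

theorem ellNorm_nonneg {n : ℕ} (p : ℝ) (v : Fin n → ℝ) : 0 ≤ ellNorm p v :=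
  Real.rpow_nonneg (Finset.sum_nonneg fun _ _ => Real.rpow_nonneg (abs_nonneg _) _) _

theorem ellNorm_rpow {n : ℕ} {p : ℝ} (hp : 0 < p) (v : Fin n → ℝ) :
    ellNorm p v ^ p = ∑ i, |v i| ^ p := by
  rw [ellNorm, ← Real.rpow_mul (Finset.sum_nonneg fun _ _ => Real.rpow_nonneg (abs_nonneg _) _),
    one_div_mul_cancel hp.ne', Real.rpow_one]

theorem ellNorm_two_sq {n : ℕ} (v : Fin n → ℝ) : ellNorm 2 v ^ 2 = ∑ i, v i ^ 2 := by
  have := ellNorm_rpow (two_pos : (0 : ℝ) < 2) v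
  rw [Real.rpow_two] at this
  rw [this]
  refine Finset.sum_congr rfl fun i _ => ?_
  rw [Real.rpow_two, sq_abs]

theorem ellNorm_le_of_abs_le {n : ℕ} {p L : ℝ} (hp : 0 < p) {v : Fin n → ℝ}
    (h : ∀ i, |v i| ≤ L) : ellNorm p v ≤ (n * L ^ p) ^ (1 / p) := by
  unfold ellNorm
  refine Real.rpow_le_rpow
    (Finset.sum_nonneg fun _ _ => Real.rpow_nonneg (abs_nonneg _) _) ?_ (by positivity)
  calc ∑ i, |v i| ^ p ≤ ∑ _i : Fin n, L ^ p :=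
        Finset.sum_le_sum fun i _ => Real.rpow_le_rpow (abs_nonneg _) (h i) hp.le
    _ = n * L ^ p := by simp

theorem grad_const_mul {n : ℕ} {φ : (Fin n → ℝ) → ℝ} (hφ : Differentiable ℝ φ) (s : ℝ)
    (x : Fin n → ℝ) (i : Fin n) : grad (fun x => s * φ x) x i = s * grad φ x i := by
  unfold grad
  rw [fderiv_const_mul (hφ x)]
  simp

theorem integrable_exp_of_abs_sub_le {n : ℕ} {μ : Fin n → Measure ℝ}
    [∀ i, IsProbabilityMeasure (μ i)] {l L s : ℝ}
    (h : ∀ i, Integrable (fun x => Real.exp (2 * l * |x|)) (μ i)) {φ : (Fin n → ℝ) → ℝ}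
    (hφ : Continuous φ) (hlip : ∀ x y, |φ x - φ y| ≤ L * ∑ i, |x i - y i|)
    (hs : |s| * L ≤ 2 * l) : Integrable (fun x => Real.exp (s * φ x)) (Measure.pi μ) := by
  refine ((integrable_exp_sum_abs h).const_mul (Real.exp (|s| * |φ 0|))).mono'
    (by fun_prop : Continuous fun x => Real.exp (s * φ x)).aestronglyMeasurable
    (Filter.Eventually.of_forall fun x => ?_)
  rw [Real.norm_of_nonneg (Real.exp_pos _).le, ← Real.exp_add]
  refine Real.exp_le_exp.2 ?_
  have h1 := hlip x 0
  simp only [Pi.zero_apply, sub_zero] at h1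
  have h2 : |φ x| ≤ |φ 0| + L * ∑ i, |x i| := by linarith [abs_sub_abs_le_abs_sub (φ x) (φ 0)]
  have h3 : (0 : ℝ) ≤ ∑ i, |x i| := Finset.sum_nonneg fun i _ => abs_nonneg _
  calc s * φ x ≤ |s| * |φ x| := by rw [← abs_mul]; exact le_abs_self _
    _ ≤ |s| * (|φ 0| + L * ∑ i, |x i|) := by gcongr
    _ = |s| * |φ 0| + (|s| * L) * ∑ i, |x i| := by ring
    _ ≤ |s| * |φ 0| + (2 * l) * ∑ i, |x i| := by gcongr
    _ = _ := by ring

theorem entropy_exp {α : Type*} [MeasurableSpace α] {μ : Measure α} {f : α → ℝ}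
    (h : Integrable (fun x => f x * Real.exp (f x)) μ) :
    entropy μ (fun x => Real.exp (f x)) = (expEnt μ f : EReal) := by
  have h1 : (fun x => Real.exp (f x) * Real.log (Real.exp (f x))) =
      fun x => f x * Real.exp (f x) := funext fun x => by rw [Real.log_exp, mul_comm]
  rw [entropy, if_pos (by rw [h1]; exact h), expEnt]
  simp only [Real.log_exp, mul_comm (Real.exp (f _))]

/-- A real upper bound excludes the value `⊤`, so an admissible inequality already contains the
integrability it needs. -/
theorem expEnt_le_of_entropy_le {α : Type*} [MeasurableSpace α] {μ : Measure α} {f : α → ℝ}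
    {r : ℝ} (h : entropy μ (fun x => Real.exp (f x)) ≤ (r : EReal)) : expEnt μ f ≤ r := by
  have h1 : (fun x => Real.exp (f x) * Real.log (Real.exp (f x))) =
      fun x => f x * Real.exp (f x) := funext fun x => by rw [Real.log_exp, mul_comm]
  by_cases hi : Integrable (fun x => f x * Real.exp (f x)) μ
  · rw [entropy_exp hi] at h
    exact EReal.coe_le_coe_iff.1 h
  · rw [entropy, if_neg (by rwa [h1])] at h
    exact absurd (top_le_iff.1 h) (EReal.coe_ne_top r)

theorem integrable_of_abs_grad_le {n : ℕ} {μ : Measure (Fin n → ℝ)} {φ : (Fin n → ℝ) → ℝ}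
    (hφ : ContDiff ℝ 1 φ) {L : ℝ} (hg : ∀ x i, |grad φ x i| ≤ L)
    (hi : Integrable (fun x => Real.exp (φ x)) μ) {G : (Fin n → ℝ) → ℝ} (hG : Continuous G) :
    Integrable (fun x => G (grad φ x) * Real.exp (φ x)) μ := by
  obtain ⟨K, hK⟩ : ∃ K, ∀ v ∈ Set.Icc (fun _ : Fin n => -L) (fun _ => L), ‖G v‖ ≤ K :=
    isCompact_Icc.exists_bound_of_continuousOn hG.continuousOn
  have hc : Continuous fun x => grad φ x := continuous_pi fun i => continuous_grad hφ i
  refine (hi.const_mul K).mono' ((hG.comp hc).mul hφ.continuous.rexp).aestronglyMeasurable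
    (Filter.Eventually.of_forall fun x => ?_)
  rw [norm_mul, Real.norm_of_nonneg (Real.exp_pos _).le]
  exact mul_le_mul_of_nonneg_right
    (hK _ ⟨fun i => (abs_le.1 (hg x i)).1, fun i => (abs_le.1 (hg x i)).2⟩) (Real.exp_pos _).le

/-- Existence of an admissible constant. -/
theorem exists_isModLogSobolevConst (β m σ : ℝ) (hβ0 : 0 ≤ β) (hβ1 : β ≤ 1) (hm : 0 < m)
    (hσ : 0 ≤ σ) : ∃ C, IsModLogSobolevConst β m σ C := by
  obtain ⟨C, hC, hline⟩ := exists_line_const β m σ hβ0 hβ1 hm hσ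
  -- The factor `2` pays for passing from the sum of coordinatewise maxima to the maximum of the two
  -- sums.
  refine ⟨2 * C, by positivity, fun n μ hμ φ hφ => ?_⟩
  have hprob : ∀ i, IsProbabilityMeasure (μ i) := fun i => (hμ i).1
  have hφ1 : ContDiff ℝ 1 φ := hφ.smooth.of_le (by exact_mod_cast le_top)
  have hdiff : Differentiable ℝ φ := hφ1.differentiable (by norm_num)
  have main : ∀ L, 0 < L → (β = 0 → L * σ ≤ 1 / 6) →
      (∀ i, Integrable (fun x => Real.exp (2 * L * |x|)) (μ i)) →
      (∀ x y, |φ x - φ y| ≤ L * ∑ i, |x i - y i|) → ∀ G : (Fin n → ℝ) → ℝ, Continuous G →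
      (∀ v, ∑ i, modCost β (v i) ≤ 2 * G v) →
      entropy (Measure.pi μ) (fun x => Real.exp (φ x)) ≤
        ((2 * C * ∫ x, G (grad φ x) * Real.exp (φ x) ∂(Measure.pi μ) : ℝ) : EReal) := by
    intro L hL hLσ hexp hlip G hG hGle
    have hgb := abs_grad_le hdiff hL.le hlip
    have hb : ∀ x, |φ x| ≤ |φ 0| + L * ∑ i, |x i| := fun x => by
      have h1 := hlip x 0
      simp only [Pi.zero_apply, sub_zero] at h1
      linarith [abs_sub_abs_le_abs_sub (φ x) (φ 0)]
    have hdom : Integrable (fun x : Fin n → ℝ => Real.exp (2 * (|φ 0| + L * ∑ i, |x i|)))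
        (Measure.pi μ) := by
      refine ((integrable_exp_sum_abs hexp).const_mul (Real.exp (2 * |φ 0|))).congr
        (Filter.Eventually.of_forall fun x => ?_)
      simp only
      rw [← Real.exp_add, mul_add]
    have hφm := hφ1.continuous.measurable
    have iE := integrable_exp_of_abs_le hφm hb hdom
    have iT := integrable_mul_exp_of_abs_le hφm hφm hb hb hdom
    rw [entropy_exp iT, EReal.coe_le_coe_iff]
    refine (expEnt_pi_le (continuous_modCost hβ0) hL hprob hexp
      (fun i => hline L hL hLσ (μ i) (hμ i) (hexp i)) hφ1 hφ.convex hlip).trans ?_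
    rw [mul_comm 2 C, mul_assoc, ← integral_const_mul 2]
    refine mul_le_mul_of_nonneg_left (integral_mono_of_nonneg
      (Filter.Eventually.of_forall fun x => mul_nonneg (Finset.sum_nonneg fun i _ =>
        (sq_nonneg _).trans (sq_le_modCost _ _)) (Real.exp_pos _).le)
      ((integrable_of_abs_grad_le hφ1 hgb iE hG).const_mul 2)
      (Filter.Eventually.of_forall fun x => ?_)) hC.le
    simp only
    rw [← mul_assoc]
    exact mul_le_mul_of_nonneg_right (hGle _) (Real.exp_pos _).le
  constructor
  · intro hβ
    obtain ⟨K, hK⟩ := hφ.lipschitz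
    have hp : 0 < (β + 1) / β := by positivity
    refine main (K + 1) (by positivity) (fun h => absurd h hβ.ne')
      (fun i => (hμ i).integrable_exp_abs_of_pos hm hσ hβ _) (abs_sub_le_of_lipschitz hK)
      (fun v => max (ellNorm 2 v ^ 2) (ellNorm ((β + 1) / β) v ^ ((β + 1) / β))) ?_ fun v => ?_
    · simp_rw [ellNorm_two_sq, ellNorm_rpow hp]
      refine Continuous.max (by fun_prop) (continuous_finsetSum _ fun i _ => ?_)
      exact (continuous_abs.comp (continuous_apply i)).rpow_const fun x => Or.inr hp.le
    · rw [ellNorm_two_sq, ellNorm_rpow hp]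
      have h1 : ∑ i, modCost β (v i) ≤ ∑ i, v i ^ 2 + ∑ i, |v i| ^ ((β + 1) / β) := by
        rw [← Finset.sum_add_distrib]
        refine Finset.sum_le_sum fun i _ => ?_
        rw [modCost, if_neg hβ.ne']
        exact max_le_add_of_nonneg (sq_nonneg _) (by positivity)
      linarith [le_max_left (∑ i, v i ^ 2) (∑ i, |v i| ^ ((β + 1) / β)),
        le_max_right (∑ i, v i ^ 2) (∑ i, |v i| ^ ((β + 1) / β))]
  · rintro rfl hg
    have hpos : 0 < m + 3 * σ := by positivity
    -- The summand `3σ` gives `L σ ≤ 1/6`, as absorption requires; it also puts `2L` within the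
    -- range of exponential moments available for `β = 0`.
    refine main (1 / (2 * (m + 3 * σ))) (by positivity) (fun _ => ?_) (fun i => ?_)
      (abs_sub_le_of_abs_grad_le hdiff hg) (fun v => ellNorm 2 v ^ 2) ?_ fun v => ?_
    · rw [div_mul_eq_mul_div, div_le_div_iff₀ (by positivity) (by norm_num)]
      linarith
    · refine (hμ i).integrable_exp_abs hm le_rfl (by positivity) ?_
      rw [zero_add, Real.rpow_one, Real.rpow_zero]
      field_simp
      linarith
    · simp_rw [ellNorm_two_sq]
      fun_prop
    · rw [ellNorm_two_sq]
      simp only [modCost, if_true]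
      have : 0 ≤ ∑ i, v i ^ 2 := Finset.sum_nonneg fun i _ => sq_nonneg _
      linarith

/-! ### Herbst's argument and concentration. -/

/-- The Herbst argument. -/
theorem cgf_le_of_expEnt_le {Ω : Type*} [MeasurableSpace Ω] {P : Measure Ω}
    [IsProbabilityMeasure P] {Y : Ω → ℝ} {K l : ℝ} (hl : 0 < l)
    (hint : ∀ s ∈ Set.Icc 0 l, s ∈ interior (integrableExpSet Y P))
    (hent : ∀ s ∈ Set.Ioc 0 l, expEnt P (fun ω => s * Y ω) ≤ K * s ^ 2 * mgf Y P s) :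
    cgf Y P l ≤ l * ∫ ω, Y ω ∂P + K * l ^ 2 := by
  have hpos : ∀ s ∈ Set.Icc 0 l, 0 < mgf Y P s := fun s hs =>
    mgf_pos (interior_subset (s := integrableExpSet Y P) (hint s hs))
  have hd : ∀ s ∈ Set.Icc 0 l,
      HasDerivAt (cgf Y P) ((∫ ω, Y ω * Real.exp (s * Y ω) ∂P) / mgf Y P s) s := fun s hs =>
    (hasDerivAt_mgf (hint s hs)).log (hpos s hs).ne'
  -- The entropy bound says exactly that `q' ≤ 0`. As `s → 0⁺`, `q` tends to the derivative of `cgf`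
  -- at `0`, which is the mean.
  set q : ℝ → ℝ := fun s => cgf Y P s / s - K * s with hq
  have hqd : ∀ s ∈ Set.Ioc 0 l, HasDerivAt q
      (((∫ ω, Y ω * Real.exp (s * Y ω) ∂P) / mgf Y P s * s - cgf Y P s) / s ^ 2 - K) s := by
    intro s hs
    have h1 := ((hd s ⟨hs.1.le, hs.2⟩).div (hasDerivAt_id' s) hs.1.ne').sub
      ((hasDerivAt_id' s).const_mul K)
    refine h1.congr_deriv ?_
    simp
  have hqneg : ∀ s ∈ Set.Ioc 0 l,
      ((∫ ω, Y ω * Real.exp (s * Y ω) ∂P) / mgf Y P s * s - cgf Y P s) / s ^ 2 - K ≤ 0 := by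
    intro s hs
    have hM := hpos s ⟨hs.1.le, hs.2⟩
    have h1 := hent s hs
    have h2 : expEnt P (fun ω => s * Y ω) =
        s * (∫ ω, Y ω * Real.exp (s * Y ω) ∂P) - mgf Y P s * cgf Y P s := by
      unfold expEnt cgf mgf
      rw [← integral_const_mul]
      simp only [mul_assoc]
    have hs2 : 0 < s ^ 2 := pow_pos hs.1 2
    rw [sub_nonpos, div_le_iff₀ hs2, sub_le_iff_le_add, div_mul_eq_mul_div, div_le_iff₀ hM]
    rw [h2] at h1
    linarith
  have hanti : AntitoneOn q (Set.Ioc 0 l) := by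
    refine antitoneOn_of_deriv_nonpos (convex_Ioc 0 l)
      (fun s hs => (hqd s hs).continuousAt.continuousWithinAt) (fun s hs => ?_) fun s hs => ?_
    · exact (hqd s (interior_subset hs)).differentiableAt.differentiableWithinAt
    · rw [(hqd s (interior_subset hs)).deriv]
      exact hqneg s (interior_subset hs)
  have hlim : Filter.Tendsto q (nhdsWithin 0 (Set.Ioi 0)) (nhds (∫ ω, Y ω ∂P)) := by
    have h0 := hd 0 ⟨le_rfl, hl.le⟩
    have h1 := (hasDerivAt_iff_tendsto_slope_zero.1 h0).mono_left
      (nhdsWithin_mono 0 fun x (hx : 0 < x) => hx.ne')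
    have h2 : Filter.Tendsto (fun s : ℝ => K * s) (nhdsWithin 0 (Set.Ioi 0)) (nhds 0) := by
      have : Filter.Tendsto (fun s : ℝ => K * s) (nhds 0) (nhds (K * 0)) :=
        (continuous_const_mul K).tendsto 0
      rw [mul_zero] at this
      exact this.mono_left nhdsWithin_le_nhds
    have h3 := h1.sub h2
    simp only [zero_add, cgf_zero, sub_zero, zero_mul, Real.exp_zero, mul_one, mgf_zero, div_one,
      smul_eq_mul] at h3
    refine h3.congr fun s => ?_
    simp only [hq]
    rw [div_eq_inv_mul]
  have hle : q l ≤ ∫ ω, Y ω ∂P := by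
    refine ge_of_tendsto hlim ?_
    filter_upwards [Ioc_mem_nhdsGT hl] with s hs
    exact hanti hs ⟨hl, le_rfl⟩ hs.2
  simp only [hq] at hle
  rw [sub_le_iff_le_add, div_le_iff₀ hl] at hle
  linarith

/-- Concentration from the entropy bound, in the form in which it is optimized. -/
theorem measureReal_ge_le_of_expEnt_le {Ω : Type*} [MeasurableSpace Ω] {P : Measure Ω}
    [IsProbabilityMeasure P] {Y : Ω → ℝ} {t T : ℝ} (ht : 0 < t) (hT : 0 < T)
    (hint : ∀ s ∈ Set.Icc 0 (T / (2 * t)), s ∈ interior (integrableExpSet Y P))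
    (hent : ∀ s ∈ Set.Ioc 0 (T / (2 * t)),
      expEnt P (fun ω => s * Y ω) ≤ t ^ 2 / T * s ^ 2 * mgf Y P s) :
    P.real {ω | ∫ ω', Y ω' ∂P + t ≤ Y ω} ≤ Real.exp (-(1 / 4) * T) := by
  have hl : 0 < T / (2 * t) := by positivity
  have h1 := cgf_le_of_expEnt_le hl hint hent
  refine (measure_ge_le_exp_cgf _ hl.le 
    (interior_subset (s := integrableExpSet Y P) (hint _ ⟨hl.le, le_rfl⟩))).trans
    (Real.exp_le_exp.2 ?_)
  -- `l = T/(2t)` minimises `K l² - l t` for `K = t²/T`, with value `T/4 - T/2`.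
  have h2 : t ^ 2 / T * (T / (2 * t)) ^ 2 = T / 4 := by field_simp; norm_num
  have h3 : T / (2 * t) * t = T / 2 := by field_simp
  rw [h2] at h1
  linarith

theorem IsSmoothConvexLipschitz.contDiff_one {n : ℕ} {φ : (Fin n → ℝ) → ℝ}
    (h : IsSmoothConvexLipschitz φ) : ContDiff ℝ 1 φ :=
  h.smooth.of_le (by exact_mod_cast le_top)

theorem IsSmoothConvexLipschitz.const_mul {n : ℕ} {φ : (Fin n → ℝ) → ℝ}
    (h : IsSmoothConvexLipschitz φ) {s : ℝ} (hs : 0 ≤ s) :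
    IsSmoothConvexLipschitz fun x => s * φ x := by
  obtain ⟨K, hK⟩ := h.lipschitz
  refine ⟨contDiff_const.mul h.smooth, h.convex.smul hs, s.toNNReal * K,
    LipschitzWith.of_dist_le_mul fun x y => ?_⟩
  have := hK.dist_le_mul x y
  rw [Real.dist_eq, ← mul_sub, abs_mul, abs_of_nonneg hs, ← Real.dist_eq, NNReal.coe_mul,
    Real.coe_toNNReal _ hs, mul_assoc]
  exact mul_le_mul_of_nonneg_left this hs

theorem bddAbove_ellNorm_grad_pow {n : ℕ} {φ : (Fin n → ℝ) → ℝ} {L p : ℝ} (hp : 0 < p)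
    (h : ∀ x i, |grad φ x i| ≤ L) :
    BddAbove (Set.range fun x => ellNorm p (grad φ x) ^ 2) :=
  ⟨((n * L ^ p) ^ (1 / p)) ^ 2, by
    rintro _ ⟨x, rfl⟩
    exact pow_le_pow_left₀ (ellNorm_nonneg _ _) (ellNorm_le_of_abs_le hp (h x)) 2⟩

theorem bddAbove_ellNorm_grad_rpow {n : ℕ} {φ : (Fin n → ℝ) → ℝ} {L p q : ℝ} (hp : 0 < p)
    (hq : 0 ≤ q) (h : ∀ x i, |grad φ x i| ≤ L) :
    BddAbove (Set.range fun x => ellNorm p (grad φ x) ^ q) :=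
  ⟨((n * L ^ p) ^ (1 / p)) ^ q, by
    rintro _ ⟨x, rfl⟩
    exact Real.rpow_le_rpow (ellNorm_nonneg _ _) (ellNorm_le_of_abs_le hp (h x)) hq⟩

theorem abs_le_ellInftyNorm {n : ℕ} (v : Fin n → ℝ) (i : Fin n) : |v i| ≤ ellInftyNorm v :=
  le_ciSup (f := fun i => |v i|) (Set.finite_range _).bddAbove i

theorem bddAbove_ellInftyNorm_grad {n : ℕ} {φ : (Fin n → ℝ) → ℝ} {L : ℝ} (hL : 0 ≤ L)
    (h : ∀ x i, |grad φ x i| ≤ L) :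
    BddAbove (Set.range fun x => ellInftyNorm (grad φ x)) :=
  ⟨L, by rintro _ ⟨x, rfl⟩; exact Real.iSup_le (h x) hL⟩

theorem integral_mul_exp_le {α : Type*} [MeasurableSpace α] {μ : Measure α} {f G : α → ℝ} {a : ℝ}
    (hG0 : ∀ x, 0 ≤ G x) (hG : ∀ x, G x ≤ a) (hi : Integrable (fun x => Real.exp (f x)) μ) :
    ∫ x, G x * Real.exp (f x) ∂μ ≤ a * ∫ x, Real.exp (f x) ∂μ := by
  rw [← integral_const_mul]
  exact integral_mono_of_nonneg
    (Filter.Eventually.of_forall fun x => mul_nonneg (hG0 x) (Real.exp_pos _).le)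
    (hi.const_mul a)
    (Filter.Eventually.of_forall fun x => mul_le_mul_of_nonneg_right (hG x) (Real.exp_pos _).le)

theorem concentration_of_pos {β m σ C : ℝ} (hβ0 : 0 < β) (hβ1 : β ≤ 1) (hm : 0 < m) (hσ : 0 ≤ σ)
    (hC : IsModLogSobolevConst β m σ C) {n : ℕ} {μ : Fin n → Measure ℝ}
    (hμ : ∀ i, MemClassM β m σ (μ i)) {φ : (Fin n → ℝ) → ℝ} (hφ : IsSmoothConvexLipschitz φ)
    {t : ℝ} (ht : 0 ≤ t) :
    (Measure.pi μ).real {x | (∫ y, φ y ∂(Measure.pi μ)) + t ≤ φ x} ≤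
      Real.exp (-(1 / 4) * min (t ^ 2 / (C * ⨆ x, ellNorm 2 (grad φ x) ^ 2))
        (t ^ (1 + β) / (C ^ β * ⨆ x, ellNorm ((β + 1) / β) (grad φ x) ^ (1 + β)))) := by
  have hprob : ∀ i, IsProbabilityMeasure (μ i) := fun i => (hμ i).1
  have hdiff : Differentiable ℝ φ := hφ.contDiff_one.differentiable (by norm_num)
  obtain ⟨K, hK⟩ := hφ.lipschitz
  have hlip := abs_sub_le_of_lipschitz hK
  have hL : (0 : ℝ) < K + 1 := by positivity
  have hgb := abs_grad_le hdiff hL.le hlip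
  set p := (β + 1) / β with hp
  have hp0 : 0 < p := by positivity
  have hp2 : 2 ≤ p := by rw [hp, le_div_iff₀ hβ0]; linarith
  set a := ⨆ x, ellNorm 2 (grad φ x) ^ 2 with ha
  set b := ⨆ x, ellNorm p (grad φ x) ^ (1 + β) with hb
  have ha0 : 0 ≤ a := Real.iSup_nonneg fun x => sq_nonneg _
  have hb0 : 0 ≤ b := Real.iSup_nonneg fun x => Real.rpow_nonneg (ellNorm_nonneg _ _) _
  have hal : ∀ x, ellNorm 2 (grad φ x) ^ 2 ≤ a :=
    le_ciSup (bddAbove_ellNorm_grad_pow two_pos hgb)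
  have hbl : ∀ x, ellNorm p (grad φ x) ^ (1 + β) ≤ b :=
    le_ciSup (bddAbove_ellNorm_grad_rpow hp0 (by positivity) hgb)
  have hC0 := hC.1
  have hCβ : 0 < C ^ β := Real.rpow_pos_of_pos hC0 _
  set T := min (t ^ 2 / (C * a)) (t ^ (1 + β) / (C ^ β * b)) with hT
  have hT0 : 0 ≤ T := le_min (by positivity) (by positivity)
  -- `T = 0` covers `t = 0` and vanishing denominators, where division by zero gives `0`; the bound
  -- is then trivially `1`.
  rcases hT0.eq_or_lt with h0 | hTpos
  · rw [← h0, mul_zero, Real.exp_zero]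
    exact measureReal_le_one
  have h1 : 0 < t ^ 2 / (C * a) := hTpos.trans_le (min_le_left _ _)
  have h2 : 0 < t ^ (1 + β) / (C ^ β * b) := hTpos.trans_le (min_le_right _ _)
  have htpos : 0 < t := ht.lt_of_ne fun h => by rw [← h] at h1; simp at h1
  have hapos : 0 < a := ha0.lt_of_ne fun h => by rw [← h] at h1; simp at h1
  have hbpos : 0 < b := hb0.lt_of_ne fun h => by rw [← h] at h2; simp at h2
  have hT1 : C * a ≤ t ^ 2 / T := by
    rw [le_div_iff₀ hTpos, mul_comm]
    exact (le_div_iff₀ (by positivity)).1 (min_le_left _ _)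
  have hT2 : T * (C ^ β * b) ≤ t ^ (1 + β) :=
    (le_div_iff₀ (by positivity)).1 (min_le_right _ _)
  -- The inequality `T ≤ t^(1+β) / (C^β b)` rearranged and raised to the power `1/β`; note `(1 +
  -- β)/β = p`.
  have hT3 : C * b ^ (1 / β) * (T / t) ^ p ≤ T := by
    have e1 : (T / t) ^ (1 + β) * (C ^ β * b) ≤ T ^ β := by
      rw [Real.div_rpow hTpos.le htpos.le, Real.rpow_add hTpos, Real.rpow_one,
        div_mul_eq_mul_div, div_le_iff₀ (Real.rpow_pos_of_pos htpos _)]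
      calc T * T ^ β * (C ^ β * b) = T ^ β * (T * (C ^ β * b)) := by ring
        _ ≤ T ^ β * t ^ (1 + β) := by gcongr
    have e2 := Real.rpow_le_rpow (by positivity) e1 (by positivity : 0 ≤ 1 / β)
    rw [Real.mul_rpow (by positivity) (by positivity), Real.mul_rpow (by positivity) hb0,
      ← Real.rpow_mul (by positivity), ← Real.rpow_mul hC0.le, ← Real.rpow_mul hTpos.le,
      mul_one_div_cancel hβ0.ne', Real.rpow_one, Real.rpow_one, mul_one_div, add_comm 1 β,
      ← hp] at e2
    linarith
  have hexp : ∀ s : ℝ, Integrable (fun x => Real.exp (s * φ x)) (Measure.pi μ) := fun s =>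
    integrable_exp_of_abs_sub_le (l := |s| * (K + 1))
      (fun i => (hμ i).integrable_exp_abs_of_pos hm hσ hβ0 _) hφ.contDiff_one.continuous hlip
      (by nlinarith [mul_nonneg (abs_nonneg s) hL.le])
  have hset : integrableExpSet φ (Measure.pi μ) = Set.univ := Set.eq_univ_of_forall hexp
  refine measureReal_ge_le_of_expEnt_le htpos hTpos (fun s _ => by simp [hset]) fun s hs => ?_
  have hent := expEnt_le_of_entropy_le ((hC.2 n μ hμ _ (hφ.const_mul hs.1.le)).1 hβ0)
  have hbd : ∀ x, max (ellNorm 2 (grad (fun x => s * φ x) x) ^ 2)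
      (ellNorm p (grad (fun x => s * φ x) x) ^ p) ≤ t ^ 2 / T * s ^ 2 / C := by
    intro x
    rw [ellNorm_two_sq, ellNorm_rpow hp0]
    simp_rw [grad_const_mul hdiff, abs_mul, mul_pow, abs_of_pos hs.1,
      Real.mul_rpow hs.1.le (abs_nonneg _)]
    rw [← Finset.mul_sum, ← Finset.mul_sum, ← ellNorm_two_sq, ← ellNorm_rpow hp0,
      le_div_iff₀ hC0]
    have q1 : s ^ 2 * ellNorm 2 (grad φ x) ^ 2 * C ≤ t ^ 2 / T * s ^ 2 := by
      calc s ^ 2 * ellNorm 2 (grad φ x) ^ 2 * C ≤ s ^ 2 * a * C := by gcongr; exact hal x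
        _ = C * a * s ^ 2 := by ring
        _ ≤ _ := by gcongr
    have q2 : s ^ p * ellNorm p (grad φ x) ^ p * C ≤ t ^ 2 / T * s ^ 2 := by
      have r1 : ellNorm p (grad φ x) ^ p ≤ b ^ (1 / β) := by
        have := Real.rpow_le_rpow (Real.rpow_nonneg (ellNorm_nonneg _ _) _) (hbl x)
          (by positivity : 0 ≤ 1 / β)
        rwa [← Real.rpow_mul (ellNorm_nonneg _ _), mul_one_div, add_comm 1 β, ← hp] at this
      -- Since `p ≥ 2`, that is `β ≤ 1`, the `p`-th power cost is quadratic in `s` up to a factor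
      -- largest at the right end of the range.
      have r2 : s ^ (p - 2) ≤ (T / t) ^ (p - 2) := by
        refine Real.rpow_le_rpow hs.1.le (hs.2.trans ?_) (by linarith)
        gcongr
        linarith
      have r3 : s ^ p = s ^ 2 * s ^ (p - 2) := by
        rw [← Real.rpow_natCast, ← Real.rpow_add hs.1]; norm_num
      have hTt : 0 < T / t := by positivity
      have r0 : 0 ≤ ellNorm p (grad φ x) ^ p := Real.rpow_nonneg (ellNorm_nonneg _ _) _
      have r4 : (T / t) ^ p = (T / t) ^ 2 * (T / t) ^ (p - 2) := by
        rw [← Real.rpow_natCast, ← Real.rpow_add hTt]; norm_num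
      have r5 : C * b ^ (1 / β) * (T / t) ^ (p - 2) ≤ t ^ 2 / T := by
        rw [r4] at hT3
        have e : t ^ 2 / T = T / (T / t) ^ 2 := by field_simp
        rw [e, le_div_iff₀ (by positivity)]
        linarith
      calc s ^ p * ellNorm p (grad φ x) ^ p * C
          ≤ s ^ 2 * (T / t) ^ (p - 2) * b ^ (1 / β) * C := by rw [r3]; gcongr
        _ = C * b ^ (1 / β) * (T / t) ^ (p - 2) * s ^ 2 := by ring
        _ ≤ _ := by gcongr
    rw [max_mul_of_nonneg _ _ hC0.le]
    exact max_le q1 q2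
  refine hent.trans ((mul_le_mul_of_nonneg_left (integral_mul_exp_le
    (fun x => le_max_of_le_left (sq_nonneg _)) hbd (hexp s)) hC0.le).trans (le_of_eq ?_))
  rw [mgf, ← mul_assoc, mul_div_cancel₀ _ hC0.ne']

theorem concentration_of_eq_zero {m σ C : ℝ} (hm : 0 < m) (hσ : 0 ≤ σ)
    (hC : IsModLogSobolevConst 0 m σ C) {n : ℕ} {μ : Fin n → Measure ℝ}
    (hμ : ∀ i, MemClassM 0 m σ (μ i)) {φ : (Fin n → ℝ) → ℝ} (hφ : IsSmoothConvexLipschitz φ)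
    {t : ℝ} (ht : 0 ≤ t) :
    (Measure.pi μ).real {x | (∫ y, φ y ∂(Measure.pi μ)) + t ≤ φ x} ≤
      Real.exp (-(1 / 4) * min (t ^ 2 / (C * ⨆ x, ellNorm 2 (grad φ x) ^ 2))
        (t / ((m + 3 * σ) * ⨆ x, ellInftyNorm (grad φ x)))) := by
  have hprob : ∀ i, IsProbabilityMeasure (μ i) := fun i => (hμ i).1
  have hdiff : Differentiable ℝ φ := hφ.contDiff_one.differentiable (by norm_num)
  obtain ⟨K, hK⟩ := hφ.lipschitz
  have hL : (0 : ℝ) < K + 1 := by positivity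
  have hgb := abs_grad_le hdiff hL.le (abs_sub_le_of_lipschitz hK)
  set a := ⨆ x, ellNorm 2 (grad φ x) ^ 2 with ha
  set b := ⨆ x, ellInftyNorm (grad φ x) with hb
  have ha0 : 0 ≤ a := Real.iSup_nonneg fun x => sq_nonneg _
  have hb0 : 0 ≤ b := Real.iSup_nonneg fun x => Real.iSup_nonneg fun i => abs_nonneg _
  have hal : ∀ x, ellNorm 2 (grad φ x) ^ 2 ≤ a :=
    le_ciSup (bddAbove_ellNorm_grad_pow two_pos hgb)
  have hbl : ∀ x i, |grad φ x i| ≤ b := fun x i => (abs_le_ellInftyNorm _ i).trans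
    (le_ciSup (bddAbove_ellInftyNorm_grad hL.le hgb) x)
  have hC0 := hC.1
  have hr : 0 < m + 3 * σ := by positivity
  set T := min (t ^ 2 / (C * a)) (t / ((m + 3 * σ) * b)) with hT
  have hT0 : 0 ≤ T := le_min (by positivity) (by positivity)
  rcases hT0.eq_or_lt with h0 | hTpos
  · rw [← h0, mul_zero, Real.exp_zero]
    exact measureReal_le_one
  have h1 : 0 < t ^ 2 / (C * a) := hTpos.trans_le (min_le_left _ _)
  have h2 : 0 < t / ((m + 3 * σ) * b) := hTpos.trans_le (min_le_right _ _)
  have htpos : 0 < t := ht.lt_of_ne fun h => by rw [← h] at h1; simp at h1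
  have hapos : 0 < a := ha0.lt_of_ne fun h => by rw [← h] at h1; simp at h1
  have hbpos : 0 < b := hb0.lt_of_ne fun h => by rw [← h] at h2; simp at h2
  have hT1 : C * a ≤ t ^ 2 / T := by
    rw [le_div_iff₀ hTpos, mul_comm]
    exact (le_div_iff₀ (by positivity)).1 (min_le_left _ _)
  have hT2 : T * ((m + 3 * σ) * b) ≤ t := (le_div_iff₀ (by positivity)).1 (min_le_right _ _)
  set l := 1 / (2 * (m + 3 * σ)) with hl
  -- The second term of the minimum is what keeps `s |∂ᵢφ| ≤ 1/(2(m + 3σ))` on the range of `s`, so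
  -- that admissibility applies to `sφ`.
  have hTl : T / (2 * t) ≤ l / b := by
    rw [hl, div_div, div_le_div_iff₀ (by positivity) (by positivity)]
    linarith
  have hi : ∀ i, Integrable (fun x => Real.exp (2 * l * |x|)) (μ i) := fun i => by
    refine (hμ i).integrable_exp_abs hm le_rfl (by positivity) ?_
    rw [zero_add, Real.rpow_one, Real.rpow_zero, hl]
    field_simp
    linarith
  -- Exponential moments hold on an open interval twice as long as needed, which puts the whole
  -- range of `s`, including `0`, in the interior.
  have hexp : Set.Ioo (-(2 * l / b)) (2 * l / b) ⊆ integrableExpSet φ (Measure.pi μ) := fun s hs =>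
    integrable_exp_of_abs_sub_le hi hφ.contDiff_one.continuous
      (abs_sub_le_of_abs_grad_le hdiff hbl) ((le_div_iff₀ hbpos).1 (abs_lt.2 hs).le)
  have hlb : 0 < l / b := by positivity
  have hmem : ∀ s ∈ Set.Icc 0 (T / (2 * t)), s ∈ Set.Ioo (-(2 * l / b)) (2 * l / b) := fun s hs =>
    ⟨by rw [mul_div_assoc]; linarith [hs.1], by rw [mul_div_assoc]; linarith [hs.2]⟩
  refine measureReal_ge_le_of_expEnt_le htpos hTpos
    (fun s hs => interior_maximal hexp isOpen_Ioo (hmem s hs)) fun s hs => ?_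
  have hent := expEnt_le_of_entropy_le ((hC.2 n μ hμ _ (hφ.const_mul hs.1.le)).2 rfl
    (fun x i => by
      rw [grad_const_mul hdiff, abs_mul, abs_of_pos hs.1, ← hl]
      exact (mul_le_mul_of_nonneg_left (hbl x i) hs.1.le).trans
        ((le_div_iff₀ hbpos).1 (hs.2.trans hTl))))
  have hbd : ∀ x, ellNorm 2 (grad (fun x => s * φ x) x) ^ 2 ≤ t ^ 2 / T * s ^ 2 / C := by
    intro x
    rw [ellNorm_two_sq]
    simp_rw [grad_const_mul hdiff, mul_pow]
    rw [← Finset.mul_sum, ← ellNorm_two_sq, le_div_iff₀ hC0]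
    calc s ^ 2 * ellNorm 2 (grad φ x) ^ 2 * C ≤ s ^ 2 * a * C := by gcongr; exact hal x
      _ = C * a * s ^ 2 := by ring
      _ ≤ _ := by gcongr
  refine hent.trans ((mul_le_mul_of_nonneg_left (integral_mul_exp_le
    (fun x => sq_nonneg _) hbd (hexp (hmem s ⟨hs.1.le, hs.2⟩))) hC0.le).trans (le_of_eq ?_))
  rw [mgf, ← mul_assoc, mul_div_cancel₀ _ hC0.ne']

theorem integrable_of_memClassM {β m σ : ℝ} (hβ0 : 0 ≤ β) (hm : 0 < m) (hσ : 0 ≤ σ) {n : ℕ}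
    {μ : Fin n → Measure ℝ} (hμ : ∀ i, MemClassM β m σ (μ i)) {φ : (Fin n → ℝ) → ℝ}
    (hφ : IsSmoothConvexLipschitz φ) : Integrable φ (Measure.pi μ) := by
  have hprob : ∀ i, IsProbabilityMeasure (μ i) := fun i => (hμ i).1
  obtain ⟨V, -, hV⟩ := exists_second_moment_bound β m σ hm hσ hβ0
  obtain ⟨K, hK⟩ := hφ.lipschitz
  have hlip := abs_sub_le_of_lipschitz hK
  have hx : ∀ i, Integrable (fun x : Fin n → ℝ => |x i|) (Measure.pi μ) := fun i => by
    have h1 : Integrable (fun x : ℝ => |x|) (μ i) := by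
      refine ((integrable_const 1).add (hV _ (hμ i)).1).mono'
        continuous_abs.aestronglyMeasurable (Filter.Eventually.of_forall fun x => ?_)
      rw [Real.norm_of_nonneg (abs_nonneg x), Pi.add_apply]
      nlinarith [sq_nonneg (|x| - 1), sq_abs x]
    exact integrable_comp_eval h1
  refine ((integrable_const |φ 0|).add
    ((integrable_finsetSum Finset.univ fun i _ => hx i).const_mul (K + 1 : ℝ))).mono'
    hφ.contDiff_one.continuous.aestronglyMeasurable (Filter.Eventually.of_forall fun x => ?_)
  have h1 := hlip x 0
  simp only [Pi.zero_apply, sub_zero] at h1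
  simp only [Pi.add_apply, Real.norm_eq_abs]
  linarith [abs_sub_abs_le_abs_sub (φ x) (φ 0)]

/-! ### The theorem for independent random variables. -/

theorem corollary1p6 (β m σ : ℝ) (hβ0 : 0 ≤ β) (hβ1 : β ≤ 1) (hm : 0 < m) (hσ : 0 ≤ σ) :
    (∃ C : ℝ, IsModLogSobolevConst β m σ C) ∧
    ∀ C : ℝ, IsModLogSobolevConst β m σ C →
    ∀ (n : ℕ) (Ω : Type*) [MeasurableSpace Ω] (P : Measure Ω) [IsProbabilityMeasure P]
      (X : Fin n → Ω → ℝ), (∀ i, Measurable (X i)) → iIndepFun X P →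
      (∀ i, MemClassM β m σ (P.map (X i))) →
    ∀ φ : (Fin n → ℝ) → ℝ, IsSmoothConvexLipschitz φ →
      Integrable (fun ω => φ (fun i => X i ω)) P ∧
      -- the bound for `0 < β ≤ 1`
      (0 < β → ∀ t : ℝ, 0 ≤ t →
        P.real {ω | (∫ ω', φ (fun i => X i ω') ∂P) + t ≤ φ (fun i => X i ω)} ≤
          Real.exp (-(3 / 16) *
            min (t ^ 2 / (C * ⨆ x, ellNorm 2 (grad φ x) ^ 2))
              (t ^ (1 + β) /
                (C ^ β * ⨆ x, ellNorm ((β + 1) / β) (grad φ x) ^ (1 + β))))) ∧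
      -- the bound for `β = 0`
      (β = 0 → ∀ t : ℝ, 0 ≤ t →
        P.real {ω | (∫ ω', φ (fun i => X i ω') ∂P) + t ≤ φ (fun i => X i ω)} ≤
          Real.exp (-(1 / 4) *
            min (t ^ 2 / (C * ⨆ x, ellNorm 2 (grad φ x) ^ 2))
              (t / ((m + 3 * σ) * ⨆ x, ellInftyNorm (grad φ x))))) ∧
      -- the degenerate case of both bounds: zero denominators, where `t / 0 = ∞` for `t > 0`
      ((∀ x, grad φ x = 0) → ∀ t : ℝ, 0 < t →
        P.real {ω | (∫ ω', φ (fun i => X i ω') ∂P) + t ≤ φ (fun i => X i ω)} = 0) := by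
  refine ⟨exists_isModLogSobolevConst β m σ hβ0 hβ1 hm hσ,
    fun C hC n Ω _ P _ X hX hind hμ φ hφ => ?_⟩
  have hXm : Measurable fun ω i => X i ω := measurable_pi_lambda _ hX
  have hlaw : P.map (fun ω i => X i ω) = Measure.pi fun i => P.map (X i) :=
    (iIndepFun_iff_map_fun_eq_pi_map fun i => (hX i).aemeasurable).1 hind
  have hφc : Continuous φ := hφ.contDiff_one.continuous
  have hdiff : Differentiable ℝ φ := hφ.contDiff_one.differentiable (by norm_num)
  have hmean : ∫ ω, φ (fun i => X i ω) ∂P = ∫ y, φ y ∂(Measure.pi fun i => P.map (X i)) := by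
    rw [← hlaw, integral_map hXm.aemeasurable hφc.aestronglyMeasurable]
  have hreal : ∀ t, P.real {ω | (∫ ω', φ (fun i => X i ω') ∂P) + t ≤ φ (fun i => X i ω)} =
      (Measure.pi fun i => P.map (X i)).real
        {x | (∫ y, φ y ∂(Measure.pi fun i => P.map (X i))) + t ≤ φ x} := by
    intro t
    rw [hmean, ← hlaw, map_measureReal_apply hXm
      (measurableSet_le measurable_const hφc.measurable)]
    rfl
  refine ⟨?_, fun hβ t ht => ?_, fun hβ t ht => ?_, fun hg t ht => ?_⟩
  · have h := integrable_of_memClassM hβ0 hm hσ hμ hφ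
    rw [← hlaw] at h
    exact h.comp_measurable hXm
  · rw [hreal]
    -- The constant `1/4` obtained is stronger than `3/16`, because the minimum is nonnegative.
    refine (concentration_of_pos hβ hβ1 hm hσ hC hμ hφ ht).trans (Real.exp_le_exp.2 ?_)
    have hCβ : 0 ≤ C ^ β := Real.rpow_nonneg hC.1.le _
    refine mul_le_mul_of_nonneg_right (by norm_num) (le_min ?_ ?_)
    · exact div_nonneg (sq_nonneg _)
        (mul_nonneg hC.1.le (Real.iSup_nonneg fun x => sq_nonneg _))
    · exact div_nonneg (Real.rpow_nonneg ht _) (mul_nonneg hCβ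
        (Real.iSup_nonneg fun x => Real.rpow_nonneg (ellNorm_nonneg _ _) _))
  · subst hβ
    rw [hreal]
    exact concentration_of_eq_zero hm hσ hC hμ hφ ht
  · have hconst : ∀ x, φ x = φ 0 := fun x => by
      have := abs_sub_le_of_abs_grad_le hdiff (L := 0) (fun x i => by simp [hg]) x 0
      rw [zero_mul] at this
      exact sub_eq_zero.1 (abs_nonpos_iff.1 this)
    have hempty : {ω | (∫ ω', φ (fun i => X i ω') ∂P) + t ≤ φ (fun i => X i ω)} = ∅ := by
      refine Set.eq_empty_of_forall_notMem fun ω hω => ?_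
      rw [Set.mem_ofPred_eq] at hω
      simp only [hconst, integral_const, probReal_univ, one_smul] at hω
      linarith
    rw [hempty, measureReal_empty]
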